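/- Let $\kappa,\tau>0$. On $\mathbb R^4_2$ let $\langle v,w\rangle=v_1w_1+v_2w_2-v_3w_3-v_4w_4$, let $$J_1=\begin{pmatrix}0&-1&0&0\\1&0&0&0\\0&0&0&-1\\0&0&1&0\end{pmatrix},\quad J_2=\begin{pmatrix}0&0&1&0\\0&0&0&-1\\1&0&0&0\\0&-1&0&0\end{pmatrix},\quad J_3=\begin{pmatrix}0&0&0&1\\0&0&1&0\\0&1&0&0\\1&0&0&0\end{pmatrix},$$ and let $\mathbb H^3_{1,\tau}$ be the anti-de Sitter space $\{q\in\mathbb R^4_2:\langle q,q\rangle=-4/\kappa\}$ with the Lorentzian metric $g_\tau(X,Y)=\langle X,Y\rangle+(1-\tau^2)\langle X,X_1\rangle\langle Y,X_1\rangle$, where $X_1(q)=\frac{\sqrt\kappa}{2}J_1q$. Put $E_1=\tau^{-1}X_1$. A helix surface in $\mathbb H^3_{1,\tau}$ with constant angle function $\nu$ is a smoothly immersed surface with a smooth normal field $N$ such that $g_\tau(N,N)=\lambda\in\{1,-1\}$ is constant and $\lambda\, g_\tau(N,E_1)=\nu$ is constant; it is spacelike if $\lambda=-1$ and timelike if $\lambda=1$.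 For real $\xi,\xi_1,\xi_2,\xi_3$ let $A(\xi,\xi_1,\xi_2,\xi_3)$ be the $4\times4$ matrix with rows $r_1,\ J_1r_1,\ r_3,\ J_1r_3$, where $$r_1=(\cosh\xi_1\cos\xi_2,\,-\cosh\xi_1\sin\xi_2,\,\sinh\xi_1\cos\xi_3,\,-\sinh\xi_1\sin\xi_3),\qquad r_3=\sin\xi\,J_2r_1+\cos\xi\,J_3r_1.$$ Let $\lambda\in\{1,-1\}$ and $\nu\in\mathbb R$ satisfy $B:=\nu^2(\tau^2-1)-\lambda>0$. When $\lambda+\nu^2>0$, put $$d=\frac{\sqrt B+\tau|\nu|}{\sqrt{\lambda+\nu^2}},$$ $$\gamma(s)=\frac{2}{\sqrt\kappa}\frac1{\sqrt{d^2-1}}\Big(\cos\big(\tfrac{\sqrt\kappa}{2}ds\big),\,-\lambda\sin\big(\tfrac{\sqrt\kappa}{2}ds\big),\,d\cos\big(\tfrac{\sqrt\kappa}{2}\tfrac sd\big),\,\lambda d\sin\big(\tfrac{\sqrt\kappa}{2}\tfrac sd\big)\Big).$$ 1. Let $M$ be a helix surface in $\mathbb H^3_{1,\tau}$ with constant angle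 function $\nu$ and $g_\tau(N,N)=\lambda$. If $M$ is non-empty, then $\lambda+\nu^2>0$, and around each of its points there are local coordinates $(s,y)$ on $M$ in which its position vector is $$F(s,y)=A(y)\gamma(s),\qquad A(y)=A(\xi,\xi_1(y),\xi_2(y),\xi_3(y)),$$ where $\xi$ is constant, $\xi_1,\xi_2,\xi_3$ are smooth functions on an open interval with $$\cosh^2(\xi_1(y))\,\xi_2'(y)+\sinh^2(\xi_1(y))\,\xi_3'(y)=0,$$ and the matrices $A(y)$ are pseudo-orthogonal (they preserve $\langle\,,\rangle$) and commute with $J_1$. 2. If $\lambda+\nu^2>0$, then $d>1$, and $\gamma$ is a twisted geodesic (a geodesic with non-constant components in both circles), parametrized by arc length with respect to $\langle\,,\rangle$ (that is, $\langle\gamma',\gamma'\rangle=1$), of the torus $$\mathbb S^1\Big(\frac{2}{\sqrt\kappa}\frac1{\sqrt{d^2-1}}\Big)\times\mathbb S^1\Big(\frac{2}{\sqrt\kappa}\frac d{\sqrt{d^2-1}}\Big)\subset\mathbb H^3_{1,\tau},$$ which is Lorentzian with the metric induced by $\langle\,,\rangle$. The slope of $\gamma$, i.e. the ratio of the Euclidean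 speeds of its components in the first and in the second circle, is $d$. 3. Conversely, if $\lambda+\nu^2>0$, then every map $F(s,y)=A(y)\gamma(s)$ with $A(y)$ as in 1, restricted to an open set of the $(s,y)$-plane on which it is an immersion, is a helix surface in $\mathbb H^3_{1,\tau}$ with constant angle function $\nu$ and $g_\tau(N,N)=\lambda$. -/

import Mathlib

open scoped Manifold ContDiff Matrix

noncomputable section

namespace AntiDeSitter

/-- The neutral scalar product `dx₁² + dx₂² - dx₃² - dx₄²` of `ℝ⁴₂`. -/
def g0 (v w : Fin 4 → ℝ) : ℝ := v 0 * w 0 + v 1 * w 1 - v 2 * w 2 - v 3 * w 3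

/-- The anti-de Sitter space `ℍ³₁(κ/4) = {q ∈ ℝ⁴₂ : ⟨q,q⟩ = -4/κ}`. -/
def AdS (κ : ℝ) : Set (Fin 4 → ℝ) := {q | g0 q q = -4 / κ}

/-- Left multiplication by the paraquaternion `i`. -/
def J1 : Matrix (Fin 4) (Fin 4) ℝ :=
  !![0, -1, 0, 0; 1, 0, 0, 0; 0, 0, 0, -1; 0, 0, 1, 0]

/-- Left multiplication by the paraquaternion `j`. -/
def J2 : Matrix (Fin 4) (Fin 4) ℝ :=
  !![0, 0, 1, 0; 0, 0, 0, -1; 1, 0, 0, 0; 0, -1, 0, 0]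

/-- Left multiplication by the paraquaternion `k`. -/
def J3 : Matrix (Fin 4) (Fin 4) ℝ :=
  !![0, 0, 0, 1; 0, 0, 1, 0; 0, 1, 0, 0; 1, 0, 0, 0]

/-- The hyperbolic Hopf vector field `X₁(q) = (√κ/2) i q`. -/
def X1 (κ : ℝ) (q : Fin 4 → ℝ) : Fin 4 → ℝ := (√κ / 2) • (J1 *ᵥ q)

/-- `X₂(q) = (√κ/2) j q`. -/
def X2 (κ : ℝ) (q : Fin 4 → ℝ) : Fin 4 → ℝ := (√κ / 2) • (J2 *ᵥ q)

/-- `X₃(q) = (√κ/2) k q`. -/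
def X3 (κ : ℝ) (q : Fin 4 → ℝ) : Fin 4 → ℝ := (√κ / 2) • (J3 *ᵥ q)

/-- The Berger-like metric `g_τ` at the point `q`, on vectors tangent to `ℍ³₁(κ/4)` at `q`:
`g_τ(X,Y) = ⟨X,Y⟩ + (1-τ²) ⟨X,X₁⟩ ⟨Y,X₁⟩`. -/
def gτ (κ τ : ℝ) (q v w : Fin 4 → ℝ) : ℝ :=
  g0 v w + (1 - τ ^ 2) * g0 v (X1 κ q) * g0 w (X1 κ q)

/-- In the frame `X₁, X₂, X₃` the metric is `-τ² θ¹⊗θ¹ + θ²⊗θ² + θ³⊗θ³`. -/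
theorem gτ_frame {κ : ℝ} (hκ : 0 < κ) (τ : ℝ) {q : Fin 4 → ℝ} (hq : q ∈ AdS κ)
    (a₁ a₂ a₃ b₁ b₂ b₃ : ℝ) :
    gτ κ τ q (a₁ • X1 κ q + a₂ • X2 κ q + a₃ • X3 κ q)
        (b₁ • X1 κ q + b₂ • X2 κ q + b₃ • X3 κ q)
      = -τ ^ 2 * (a₁ * b₁) + a₂ * b₂ + a₃ * b₃ := by
  have hs : √κ ^ 2 = κ := Real.sq_sqrt hκ.le
  have hq' : q 0 * q 0 + q 1 * q 1 - q 2 * q 2 - q 3 * q 3 = -4 / κ := hq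
  have hn : √κ ^ 2 * (q 0 * q 0 + q 1 * q 1 - q 2 * q 2 - q 3 * q 3) = -4 := by
    rw [hs, hq']; field_simp
  have e (x₁ x₂ x₃ : ℝ) : g0 (x₁ • X1 κ q + x₂ • X2 κ q + x₃ • X3 κ q) (X1 κ q) = -x₁ := by
    simp [g0, X1, X2, X3, J1, J2, J3, dotProduct, Fin.sum_univ_four]
    linear_combination (x₁ / 4) * hn
  rw [gτ, e, e]
  simp [g0, X1, X2, X3, J1, J2, J3, dotProduct, Fin.sum_univ_four]
  linear_combination ((a₁ * b₁ - a₂ * b₂ - a₃ * b₃) / 4) * hn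

/-- The unit timelike vector field `E₁ = τ⁻¹ X₁`. -/
def E1 (κ τ : ℝ) (q : Fin 4 → ℝ) : Fin 4 → ℝ := τ⁻¹ • X1 κ q

/-- `f : M → ℝ⁴` is (the position vector of) a surface `M` immersed in `ℍ³₁(κ/4)` endowed with `g_τ`,
oriented by a smooth unit normal field `N` with `g_τ(N,N) = lam`, whose angle function
`lam * g_τ(N,E₁)` is constantly equal to `ν`. For `lam = -1` the surface is spacelike, for `lam = 1`
it is timelike. -/
structure IsHelixSurface (κ τ lam ν : ℝ) {M : Type*} [TopologicalSpace M]
    [ChartedSpace (EuclideanSpace ℝ (Fin 2)) M] (f : M → Fin 4 → ℝ) : Prop where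
  smooth : ContMDiff (𝓡 2) 𝓘(ℝ, Fin 4 → ℝ) ∞ f
  mem_AdS : ∀ p, f p ∈ AdS κ
  immersion : ∀ p, Function.Injective (mfderiv (𝓡 2) 𝓘(ℝ, Fin 4 → ℝ) f p)
  exists_normal : ∃ N : M → Fin 4 → ℝ, ContMDiff (𝓡 2) 𝓘(ℝ, Fin 4 → ℝ) ∞ N ∧
    ∀ p,
      -- `N p` is tangent to the anti-de Sitter space at `f p`
      g0 (f p) (N p) = 0 ∧
      -- `N p` is orthogonal to the surface and of causal character `lam`
      (∀ v : TangentSpace (𝓡 2) p,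
        gτ κ τ (f p) (mfderiv (𝓡 2) 𝓘(ℝ, Fin 4 → ℝ) f p v) (N p) = 0) ∧
      gτ κ τ (f p) (N p) (N p) = lam ∧
      lam * gτ κ τ (f p) (N p) (E1 κ τ (f p)) = ν

/-- The constant `B = ν²(τ²-1) - lam`. -/
def B (τ lam ν : ℝ) : ℝ := ν ^ 2 * (τ ^ 2 - 1) - lam

/-- The slope `d = (√B + τ|ν|) / √(lam + ν²)`. -/
def slope (τ lam ν : ℝ) : ℝ := (√(B τ lam ν) + τ * |ν|) / √(lam + ν ^ 2)

/-- The curve `γ`. -/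
def curve (κ lam d s : ℝ) : Fin 4 → ℝ :=
  (2 / √κ * (1 / √(d ^ 2 - 1))) •
    ![Real.cos (√κ / 2 * d * s), -lam * Real.sin (√κ / 2 * d * s),
      d * Real.cos (√κ / 2 * (s / d)), lam * d * Real.sin (√κ / 2 * (s / d))]

/-- The torus `𝕊¹(r₁) × 𝕊¹(r₂)` in `ℝ⁴₂`. -/
def torus (r₁ r₂ : ℝ) : Set (Fin 4 → ℝ) :=
  {q | q 0 ^ 2 + q 1 ^ 2 = r₁ ^ 2 ∧ q 2 ^ 2 + q 3 ^ 2 = r₂ ^ 2}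

/-- The tangent plane of the product torus (of positive radii) through `q` at `q`. -/
def torusTangent (q : Fin 4 → ℝ) : Submodule ℝ (Fin 4 → ℝ) where
  carrier := {v | q 0 * v 0 + q 1 * v 1 = 0 ∧ q 2 * v 2 + q 3 * v 3 = 0}
  zero_mem' := by simp
  add_mem' := by
    rintro v w ⟨h1, h2⟩ ⟨h3, h4⟩
    simp only [Set.mem_ofPred_eq, Pi.add_apply]
    constructor <;> linarith
  smul_mem' := by
    rintro c v ⟨h1, h2⟩
    simp only [Set.mem_ofPred_eq, Pi.smul_apply, smul_eq_mul]
    exact ⟨by linear_combination c * h1, by linear_combination c * h2⟩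

/-- The metric induced by `g0` on the torus has signature `(1,1)`. -/
def IsLorentzTorus (r₁ r₂ : ℝ) : Prop :=
  0 < r₁ ∧ 0 < r₂ ∧ ∀ q ∈ torus r₁ r₂, ∃ u v : Fin 4 → ℝ,
    torusTangent q = Submodule.span ℝ {u, v} ∧ g0 u u = 1 ∧ g0 v v = -1 ∧ g0 u v = 0

/-- `c` is a geodesic of the torus with the metric induced by `g0`: its acceleration in `ℝ⁴₂` has no
component tangent to the torus. -/
structure IsTorusGeodesic (r₁ r₂ : ℝ) (c : ℝ → Fin 4 → ℝ) : Prop where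
  smooth : ContDiff ℝ ∞ c
  mem_torus : ∀ s, c s ∈ torus r₁ r₂
  acceleration : ∀ s, ∀ v ∈ torusTangent (c s), g0 (deriv (deriv c) s) v = 0

/-- The speed of the component of `c` in the first circle. -/
def speed₁ (c : ℝ → Fin 4 → ℝ) (s : ℝ) : ℝ := √(deriv c s 0 ^ 2 + deriv c s 1 ^ 2)

/-- The speed of the component of `c` in the second circle. -/
def speed₂ (c : ℝ → Fin 4 → ℝ) (s : ℝ) : ℝ := √(deriv c s 2 ^ 2 + deriv c s 3 ^ 2)

/-- A geodesic of the torus that winds around both circle factors. -/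
def IsTwistedGeodesic (r₁ r₂ : ℝ) (c : ℝ → Fin 4 → ℝ) : Prop :=
  IsTorusGeodesic r₁ r₂ c ∧ ∀ s, speed₁ c s ≠ 0 ∧ speed₂ c s ≠ 0

/-- The signature matrix of `ℝ⁴₂`. -/
def epsMatrix : Matrix (Fin 4) (Fin 4) ℝ := Matrix.diagonal ![1, 1, -1, -1]

/-- Membership in the pseudo-orthogonal group `O₂(4)`. -/
def IsPseudoOrthogonal (A : Matrix (Fin 4) (Fin 4) ℝ) : Prop :=
  IsUnit A.det ∧ Aᵀ = epsMatrix * A⁻¹ * epsMatrix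

/-- The first row of `A(ξ,ξ₁,ξ₂,ξ₃)`. -/
def row1 (ξ₁ ξ₂ ξ₃ : ℝ) : Fin 4 → ℝ :=
  ![Real.cosh ξ₁ * Real.cos ξ₂, -Real.cosh ξ₁ * Real.sin ξ₂,
    Real.sinh ξ₁ * Real.cos ξ₃, -Real.sinh ξ₁ * Real.sin ξ₃]

/-- The third row of `A(ξ,ξ₁,ξ₂,ξ₃)`. -/
def row3 (ξ ξ₁ ξ₂ ξ₃ : ℝ) : Fin 4 → ℝ :=
  Real.sin ξ • (J2 *ᵥ row1 ξ₁ ξ₂ ξ₃) + Real.cos ξ • (J3 *ᵥ row1 ξ₁ ξ₂ ξ₃)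

/-- The matrix `A(ξ,ξ₁,ξ₂,ξ₃)`, with rows `r₁`, `J₁ r₁`, `r₃`, `J₁ r₃`. -/
def matA (ξ ξ₁ ξ₂ ξ₃ : ℝ) : Matrix (Fin 4) (Fin 4) ℝ :=
  Matrix.of ![row1 ξ₁ ξ₂ ξ₃, J1 *ᵥ row1 ξ₁ ξ₂ ξ₃, row3 ξ ξ₁ ξ₂ ξ₃, J1 *ᵥ row3 ξ ξ₁ ξ₂ ξ₃]

/-- `ξ₁, ξ₂, ξ₃` are smooth functions on the open interval `I` satisfying
`cosh²(ξ₁) ξ₂' + sinh²(ξ₁) ξ₃' = 0`. -/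
structure IsAdmissible (I : Set ℝ) (ξ₁ ξ₂ ξ₃ : ℝ → ℝ) : Prop where
  isOpen : IsOpen I
  interval : I.OrdConnected
  smooth₁ : ContDiffOn ℝ ∞ ξ₁ I
  smooth₂ : ContDiffOn ℝ ∞ ξ₂ I
  smooth₃ : ContDiffOn ℝ ∞ ξ₃ I
  ode : ∀ y ∈ I,
    Real.cosh (ξ₁ y) ^ 2 * deriv ξ₂ y + Real.sinh (ξ₁ y) ^ 2 * deriv ξ₃ y = 0

/-- The map `F(s,y) = A(y) γ(s)` with `A(y) = A(ξ,ξ₁(y),ξ₂(y),ξ₃(y))`, where `s` and `y` are the two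
coordinates of `p`. -/
def param (κ lam d ξ : ℝ) (ξ₁ ξ₂ ξ₃ : ℝ → ℝ) (p : EuclideanSpace ℝ (Fin 2)) : Fin 4 → ℝ :=
  matA ξ (ξ₁ (p 1)) (ξ₂ (p 1)) (ξ₃ (p 1)) *ᵥ curve κ lam d (p 0)

end AntiDeSitter

end

open scoped ComplexConjugate

noncomputable section

namespace AntiDeSitter

/-! Identify `ℝ⁴` with `ℂ²`, so that `J1` is multiplication by `i` and `g0` is the real part of the
Hermitian form `z z̄' - w w̄'` of signature (1,1). The matrices `matA` are then elements of U(1,1):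
first row `(z, w) = (cosh ξ₁ e^{iξ₂}, sinh ξ₁ e^{iξ₃})`, determinant `-i e^{iξ}`. The relation
between `ξ₂'` and `ξ₃'` says that `(z, w)` is tangent to the contact distribution of SU(1,1), the
kernel of `z̄ dz - w dw̄`.

A unit normal `N` at `q` with the prescribed angle is equivalent to a vector `Q` (`conormal`) such
that `J1 Q` is `g0`-dual to `gτ(·, N)` up to a factor, and all Hermitian products of `q` and `Q` are
real constants depending only on `κ` and the slope `d` (`conormal_facts`,
`isAngleNormal_ofConormal`). Hence `q = r (e₁ + d e₂)` and `Q = r (-e₁ + d e₂)` for a Hermitian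
orthonormal frame `e₁, e₂`, that is, an element of U(1,1). Its determinant has modulus one; its
argument defines `s`, and removing the phases of `γ(s)` leaves an element of SU(1,1)
(`exists_spun`). So every position vector with such a normal is `A γ(s)`, with `A` and `s` smooth
functions on the surface.

Orthogonality of `N` to the surface becomes the vanishing of the contact form on `A`; the
differential of `s` drops out because of the two frequencies of `γ` (`conormal_identity`,
`g0_J1_deriv_isSpun`). A map from a surface into a contact three-manifold that annihilates the
contact form has rank at most one where the second coordinate of the immersion must come from it, so
`A` depends on a single variable `y` and `(s, y)` are coordinates (`eq_zero_of_contact`,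
`exists_polar_chart`). Smooth polar coordinates on SU(1,1) give the `ξᵢ` (`exists_polar`). The same
identities read backwards give the converse.

Finally, `lam + ν²` is the squared length of the horizontal part of `N`. If it vanished, the surface
would be an integral surface of the horizontal contact distribution of the Hopf fibration, which
does not exist (`IsLocalHelix.pos`). -/

/-! ### Complex coordinates, and the matrices `A` as elements of U(1,1) -/

/-- The first complex coordinate of `ℝ⁴ = ℂ²`. -/
def zc : (Fin 4 → ℝ) →L[ℝ] ℂ :=
  (Complex.equivRealProdCLM.symm : ℝ × ℝ →L[ℝ] ℂ).comp
    ((ContinuousLinearMap.proj 0).prod (ContinuousLinearMap.proj 1))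

/-- The second complex coordinate of `ℝ⁴ = ℂ²`. -/
def wc : (Fin 4 → ℝ) →L[ℝ] ℂ :=
  (Complex.equivRealProdCLM.symm : ℝ × ℝ →L[ℝ] ℂ).comp
    ((ContinuousLinearMap.proj 2).prod (ContinuousLinearMap.proj 3))

@[simp] theorem zc_re (q : Fin 4 → ℝ) : (zc q).re = q 0 := by simp [zc]
@[simp] theorem zc_im (q : Fin 4 → ℝ) : (zc q).im = q 1 := by simp [zc]
@[simp] theorem wc_re (q : Fin 4 → ℝ) : (wc q).re = q 2 := by simp [wc]
@[simp] theorem wc_im (q : Fin 4 → ℝ) : (wc q).im = q 3 := by simp [wc]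

theorem ext_zc_wc {p q : Fin 4 → ℝ} (h₁ : zc p = zc q) (h₂ : wc p = wc q) : p = q := by
  rw [Complex.ext_iff] at h₁ h₂
  simp only [zc_re, zc_im, wc_re, wc_im] at h₁ h₂
  ext i
  fin_cases i
  exacts [h₁.1, h₁.2, h₂.1, h₂.2]

theorem g0_eq_re (p q : Fin 4 → ℝ) : g0 p q = (zc p * conj (zc q) - wc p * conj (wc q)).re := by
  simp [g0]; ring

theorem g0_comm (p q : Fin 4 → ℝ) : g0 p q = g0 q p := by simp only [g0]; ring

theorem g0_add_left (p q r : Fin 4 → ℝ) : g0 (p + q) r = g0 p r + g0 q r := by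
  simp only [g0, Pi.add_apply]; ring

theorem g0_sub_left (p q r : Fin 4 → ℝ) : g0 (p - q) r = g0 p r - g0 q r := by
  simp only [g0, Pi.sub_apply]; ring

theorem g0_smul_left (c : ℝ) (p r : Fin 4 → ℝ) : g0 (c • p) r = c * g0 p r := by
  simp only [g0, Pi.smul_apply, smul_eq_mul]; ring

theorem g0_add_right (p q r : Fin 4 → ℝ) : g0 r (p + q) = g0 r p + g0 r q := by
  simp only [g0, Pi.add_apply]; ring

theorem g0_sub_right (p q r : Fin 4 → ℝ) : g0 r (p - q) = g0 r p - g0 r q := by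
  simp only [g0, Pi.sub_apply]; ring

theorem g0_smul_right (c : ℝ) (p r : Fin 4 → ℝ) : g0 r (c • p) = c * g0 r p := by
  simp only [g0, Pi.smul_apply, smul_eq_mul]; ring

theorem J1_mulVec (q : Fin 4 → ℝ) : J1 *ᵥ q = ![-q 1, q 0, -q 3, q 2] := by
  ext i; fin_cases i <;> simp [J1, Matrix.mulVec, dotProduct, Fin.sum_univ_four]

theorem J2_mulVec (q : Fin 4 → ℝ) : J2 *ᵥ q = ![q 2, -q 3, q 0, -q 1] := by
  ext i; fin_cases i <;> simp [J2, Matrix.mulVec, dotProduct, Fin.sum_univ_four]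

theorem J3_mulVec (q : Fin 4 → ℝ) : J3 *ᵥ q = ![q 3, q 2, q 1, q 0] := by
  ext i; fin_cases i <;> simp [J3, Matrix.mulVec, dotProduct, Fin.sum_univ_four]

theorem J1_J1_mulVec (q : Fin 4 → ℝ) : J1 *ᵥ (J1 *ᵥ q) = -q := by
  rw [J1_mulVec, J1_mulVec]; ext i; fin_cases i <;> simp

@[simp] theorem zc_J1 (q : Fin 4 → ℝ) : zc (J1 *ᵥ q) = Complex.I * zc q := by
  rw [J1_mulVec]; apply Complex.ext <;> simp

@[simp] theorem wc_J1 (q : Fin 4 → ℝ) : wc (J1 *ᵥ q) = Complex.I * wc q := by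
  rw [J1_mulVec]; apply Complex.ext <;> simp

theorem g0_J1_left (p q : Fin 4 → ℝ) : g0 (J1 *ᵥ p) q = -g0 p (J1 *ᵥ q) := by
  simp [g0, J1_mulVec]; ring

theorem g0_J1_J1 (p q : Fin 4 → ℝ) : g0 (J1 *ᵥ p) (J1 *ᵥ q) = g0 p q := by
  simp [g0, J1_mulVec]; ring

theorem g0_J1_self (p : Fin 4 → ℝ) : g0 p (J1 *ᵥ p) = 0 := by
  simp [g0, J1_mulVec]; ring

/-- Together with `wc_matA` this exhibits the matrix as the complex matrix with rows `(z, w)` and `δ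
(w̄, z̄)`, where `|z|² - |w|² = 1` and `δ = -i e^{iξ}`: the general form of an element of U(1,1)
with determinant `δ`. -/
theorem zc_matA (ξ ξ₁ ξ₂ ξ₃ : ℝ) (q : Fin 4 → ℝ) :
    zc (matA ξ ξ₁ ξ₂ ξ₃ *ᵥ q) =
      Real.cosh ξ₁ * Complex.exp (ξ₂ * Complex.I) * zc q +
        Real.sinh ξ₁ * Complex.exp (ξ₃ * Complex.I) * wc q := by
  apply Complex.ext <;>
  simp [matA, row1, J1_mulVec, dotProduct, Fin.sum_univ_four, Complex.exp_ofReal_mul_I_re,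
    Complex.exp_ofReal_mul_I_im, -Complex.ofReal_cosh, -Complex.ofReal_sinh] <;> ring

theorem wc_matA (ξ ξ₁ ξ₂ ξ₃ : ℝ) (q : Fin 4 → ℝ) :
    wc (matA ξ ξ₁ ξ₂ ξ₃ *ᵥ q) = -Complex.I * Complex.exp (ξ * Complex.I) *
      (conj (Real.sinh ξ₁ * Complex.exp (ξ₃ * Complex.I)) * zc q +
        conj (Real.cosh ξ₁ * Complex.exp (ξ₂ * Complex.I)) * wc q) := by
  apply Complex.ext <;>
  simp [matA, row1, row3, J1_mulVec, J2_mulVec, J3_mulVec, dotProduct,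
    Fin.sum_univ_four, Complex.exp_ofReal_mul_I_re, Complex.exp_ofReal_mul_I_im,
    -Complex.ofReal_cosh, -Complex.ofReal_sinh] <;> ring

theorem matA_commute_J1 (ξ ξ₁ ξ₂ ξ₃ : ℝ) :
    matA ξ ξ₁ ξ₂ ξ₃ * J1 = J1 * matA ξ ξ₁ ξ₂ ξ₃ := by
  apply Matrix.ext_of_mulVec_single
  intro i
  rw [← Matrix.mulVec_mulVec, ← Matrix.mulVec_mulVec]
  apply ext_zc_wc <;> simp only [zc_matA, wc_matA, zc_J1, wc_J1] <;> ring

theorem norm_delta (ξ : ℝ) : (-Complex.I * Complex.exp (ξ * Complex.I)) *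
    conj (-Complex.I * Complex.exp (ξ * Complex.I)) = 1 := by
  rw [Complex.mul_conj, Complex.normSq_eq_norm_sq]
  simp [Complex.norm_exp_ofReal_mul_I]

theorem norm_expI (ξ : ℝ) : Complex.exp (ξ * Complex.I) *
    conj (Complex.exp (ξ * Complex.I)) = 1 := by
  rw [Complex.mul_conj, Complex.normSq_eq_norm_sq]
  simp [Complex.norm_exp_ofReal_mul_I]

theorem g0_matA (ξ ξ₁ ξ₂ ξ₃ : ℝ) (p q : Fin 4 → ℝ) :
    g0 (matA ξ ξ₁ ξ₂ ξ₃ *ᵥ p) (matA ξ ξ₁ ξ₂ ξ₃ *ᵥ q) = g0 p q := by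
  rw [g0_eq_re, g0_eq_re, zc_matA, zc_matA, wc_matA, wc_matA]
  congr 1
  have hδ := norm_delta ξ
  have h2 := norm_expI ξ₂
  have h3 := norm_expI ξ₃
  have hc : (Real.cosh ξ₁ : ℂ) ^ 2 - (Real.sinh ξ₁ : ℂ) ^ 2 = 1 := by
    exact_mod_cast Real.cosh_sq_sub_sinh_sq ξ₁
  generalize -Complex.I * Complex.exp (ξ * Complex.I) = δ at *
  generalize Complex.exp (ξ₂ * Complex.I) = e2 at *
  generalize Complex.exp (ξ₃ * Complex.I) = e3 at *
  simp only [map_add, map_mul, Complex.conj_conj, Complex.conj_ofReal]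
  generalize (Real.cosh ξ₁ : ℂ) = c at *
  generalize (Real.sinh ξ₁ : ℂ) = s at *
  generalize conj δ = δ' at *
  generalize conj e2 = e2' at *
  generalize conj e3 = e3' at *
  linear_combination (-(s * e3' * zc p + c * e2' * wc p) *
      (s * e3 * conj (zc q) + c * e2 * conj (wc q))) * hδ
    + (c ^ 2 * zc p * conj (zc q) - c ^ 2 * wc p * conj (wc q)) * h2
    + (-s ^ 2 * zc p * conj (zc q) + s ^ 2 * wc p * conj (wc q)) * h3
    + (zc p * conj (zc q) - wc p * conj (wc q)) * hc

theorem isPseudoOrthogonal_matA (ξ ξ₁ ξ₂ ξ₃ : ℝ) : IsPseudoOrthogonal (matA ξ ξ₁ ξ₂ ξ₃) := by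
  set A := matA ξ ξ₁ ξ₂ ξ₃ with hA
  have e1 : epsMatrix * epsMatrix = 1 := by
    simp only [epsMatrix, Matrix.diagonal_mul_diagonal]
    rw [← Matrix.diagonal_one]; congr 1; ext i; fin_cases i <;> simp
  -- Preservation of the form means `Aᵀ ε A = ε`; as `ε² = 1`, the matrix `ε Aᵀ ε` is a left inverse
  -- of `A`.
  have key : (epsMatrix * Aᵀ * epsMatrix) * A = 1 := by
    have hg (p q : Fin 4 → ℝ) : g0 p q = p ⬝ᵥ (epsMatrix *ᵥ q) := by
      simp [g0, epsMatrix, dotProduct, Fin.sum_univ_four, Matrix.mulVec_diagonal]; ring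
    have h : Aᵀ * epsMatrix * A = epsMatrix := by
      ext i j
      have := g0_matA ξ ξ₁ ξ₂ ξ₃ (Pi.single i 1) (Pi.single j 1)
      rw [hg, hg, ← hA] at this
      rw [Matrix.mulVec_mulVec, Matrix.dotProduct_mulVec, Matrix.vecMul_mulVec,
        ← Matrix.dotProduct_mulVec] at this
      simpa [Matrix.mul_assoc] using this
    rw [Matrix.mul_assoc, Matrix.mul_assoc, ← Matrix.mul_assoc Aᵀ, h, e1]
  refine ⟨Matrix.isUnit_det_of_left_inverse key, ?_⟩
  rw [Matrix.inv_eq_left_inv key]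
  simp only [Matrix.mul_assoc, e1, Matrix.mul_one]
  rw [← Matrix.mul_assoc, e1, Matrix.one_mul]

/-! ### The contact form as orthogonality condition -/

/-- Pairs `J1 Q` with the velocity of `q = A γ(s)`, up to `r²`; `dσ` and `dρ` are the variations of
the two phases. The result splits into the contact form of `A` and the combination `dσ + d² dρ`. -/
theorem conormal_identity {z w e₁ e₂ δ dz dw : ℂ} (dσ dρ d : ℝ)
    (hδ : δ * conj δ = 1) (h₁ : e₁ * conj e₁ = 1) (h₂ : e₂ * conj e₂ = 1)
    (h : z * conj z - w * conj w = 1)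
    (hd : conj z * dz + z * conj dz - w * conj dw - conj w * dw = 0) :
    (Complex.I * ((-(z * e₁) + d * (w * e₂)) *
        conj (dz * e₁ + z * (Complex.I * dσ * e₁) + d * (dw * e₂ + w * (Complex.I * dρ * e₂))) -
      (δ * (-(conj w * e₁) + d * (conj z * e₂))) *
        conj (δ * (conj dw * e₁ + conj w * (Complex.I * dσ * e₁) +
          d * (conj dz * e₂ + conj z * (Complex.I * dρ * e₂)))))).re =
      (d ^ 2 - 1) * (conj z * dz - w * conj dw).im - (dσ + d ^ 2 * dρ) := by
  -- The terms mixing the two phases add up to `Y + conj Y`, which is real and so disappears from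
  -- the real part after multiplication by `i`.
  set Y : ℂ := d * e₁ * conj e₂ * (conj w * dz - z * conj dw) with hY
  have key : (-(z * e₁) + d * (w * e₂)) *
        conj (dz * e₁ + z * (Complex.I * dσ * e₁) + d * (dw * e₂ + w * (Complex.I * dρ * e₂))) -
      (δ * (-(conj w * e₁) + d * (conj z * e₂))) *
        conj (δ * (conj dw * e₁ + conj w * (Complex.I * dσ * e₁) +
          d * (conj dz * e₂ + conj z * (Complex.I * dρ * e₂)))) =
      (1 - d ^ 2) * (conj z * dz - w * conj dw) + Complex.I * (dσ + d ^ 2 * dρ)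
        + (Y + conj Y) := by
    rw [hY]
    simp only [map_add, map_mul, Complex.conj_conj, Complex.conj_ofReal, Complex.conj_I, map_sub]
    generalize conj δ = δ' at *
    generalize conj e₁ = e₁' at *
    generalize conj e₂ = e₂' at *
    generalize conj z = z' at *
    generalize conj w = w' at *
    generalize conj dz = dz' at *
    generalize conj dw = dw' at *
    generalize Complex.I = i at *
    linear_combination
      (-(-(w' * e₁) + d * (z' * e₂)) * (dw * e₁' - i * dσ * w * e₁' + d * (dz * e₂' - i * dρ * z * e₂')))
        * hδ
      + (-z * dz' + i * dσ * z * z' + w' * dw - i * dσ * w * w') * h₁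
      + d ^ 2 * (w * dw' - i * dρ * w * w' - z' * dz + i * dρ * z * z') * h₂
      + i * (dσ + d ^ 2 * dρ) * h - hd
  have hY' : (Y + conj Y).im = 0 := by simp
  rw [key, mul_add, Complex.add_re, Complex.mul_re Complex.I (Y + conj Y), hY']
  have e : Complex.I * ((1 - d ^ 2) * (conj z * dz - w * conj dw) +
      Complex.I * (dσ + d ^ 2 * dρ)) =
      ((1 - d ^ 2 : ℝ) : ℂ) * (Complex.I * (conj z * dz - w * conj dw)) -
        ((dσ + d ^ 2 * dρ : ℝ) : ℂ) := by
    push_cast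
    linear_combination (dσ + d ^ 2 * dρ : ℂ) * Complex.I_sq
  rw [e, Complex.sub_re, Complex.re_ofReal_mul, Complex.I_mul_re, Complex.ofReal_re, Complex.I_re]
  ring

/-! ### Smooth division and smooth arguments -/

open Metric Filter Topology

/-- The weight `t ^ k` makes the family closed under differentiation: `(k, f)` becomes `(k + 1,
f')`, which is what the induction for smoothness needs. -/
theorem hasDerivAt_integral_pow_smul {f : ℝ → ℂ} (hf : ContDiff ℝ ∞ f) (k : ℕ) (y : ℝ) :
    HasDerivAt (fun y => ∫ t in (0 : ℝ)..1, ((t ^ k : ℝ) : ℂ) * f (t * y))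
      (∫ t in (0 : ℝ)..1, ((t ^ (k + 1) : ℝ) : ℂ) * deriv f (t * y)) y := by
  have hf' : Continuous (deriv f) := hf.continuous_deriv (by simp)
  have hc : Continuous fun p : ℝ × ℝ => ((p.1 ^ (k + 1) : ℝ) : ℂ) * deriv f (p.1 * p.2) := by
    fun_prop
  obtain ⟨C, hC⟩ := ((isCompact_Icc (a := (0 : ℝ)) (b := 1)).prod
    (isCompact_closedBall y 1)).exists_bound_of_continuousOn hc.continuousOn
  have hfc : Continuous f := hf.continuous
  refine (intervalIntegral.hasDerivAt_integral_of_dominated_loc_of_deriv_le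
    (s := ball y 1) (bound := fun _ => C)
    (F := fun y t => ((t ^ k : ℝ) : ℂ) * f (t * y))
    (F' := fun y t => ((t ^ (k + 1) : ℝ) : ℂ) * deriv f (t * y))
    (ball_mem_nhds y one_pos) ?_ ?_ ?_ ?_ ?_ ?_).2
  · exact Eventually.of_forall fun x => (by fun_prop : Continuous fun t : ℝ =>
      ((t ^ k : ℝ) : ℂ) * f (t * x)).aestronglyMeasurable
  · exact (by fun_prop : Continuous fun t : ℝ =>
      ((t ^ k : ℝ) : ℂ) * f (t * y)).intervalIntegrable _ _
  · exact (by fun_prop : Continuous fun t : ℝ =>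
      ((t ^ (k + 1) : ℝ) : ℂ) * deriv f (t * y)).aestronglyMeasurable
  · refine Eventually.of_forall fun t ht x hx => hC (t, x) ⟨?_, ball_subset_closedBall hx⟩
    rw [Set.uIoc_of_le zero_le_one] at ht
    exact ⟨ht.1.le, ht.2⟩
  · exact intervalIntegrable_const
  · refine Eventually.of_forall fun t _ x _ => ?_
    have h1 : HasDerivAt f (deriv f (t * x)) (t * x) :=
      (hf.differentiable (by simp) _).hasDerivAt
    have h2 : HasDerivAt (fun x : ℝ => t * x) t x := by simpa using (hasDerivAt_id x).const_mul t
    have h3 := (h1.scomp x h2).const_mul ((t ^ k : ℝ) : ℂ)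
    refine h3.congr_deriv ?_
    simp only [Complex.real_smul]
    push_cast
    ring

theorem contDiff_integral_pow_smul {f : ℝ → ℂ} (hf : ContDiff ℝ ∞ f) (k : ℕ) :
    ContDiff ℝ ∞ (fun y => ∫ t in (0 : ℝ)..1, ((t ^ k : ℝ) : ℂ) * f (t * y)) := by
  rw [contDiff_infty]
  intro n
  induction n generalizing f k with
  | zero =>
    exact contDiff_zero.2 (continuous_iff_continuousAt.2 fun y =>
      (hasDerivAt_integral_pow_smul hf k y).continuousAt)
  | succ n ih =>
    rw [Nat.cast_succ, contDiff_succ_iff_deriv]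
    refine ⟨fun y => (hasDerivAt_integral_pow_smul hf k y).differentiableAt, by simp, ?_⟩
    have : deriv (fun y => ∫ t in (0 : ℝ)..1, ((t ^ k : ℝ) : ℂ) * f (t * y)) =
        fun y => ∫ t in (0 : ℝ)..1, ((t ^ (k + 1) : ℝ) : ℂ) * deriv f (t * y) :=
      funext fun y => (hasDerivAt_integral_pow_smul hf k y).deriv
    rw [this]
    exact ih (contDiff_infty_iff_deriv.1 hf).2 (k + 1)

/-- Hadamard's lemma in one variable. -/
theorem exists_smooth_quotient {f : ℝ → ℂ} (hf : ContDiff ℝ ∞ f) (y₀ : ℝ) (h0 : f y₀ = 0) :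
    ∃ h : ℝ → ℂ, ContDiff ℝ ∞ h ∧ (∀ y, f y = ((y - y₀ : ℝ) : ℂ) * h y) ∧ h y₀ = deriv f y₀ := by
  have hg : ContDiff ℝ ∞ (fun x => deriv f (y₀ + x)) := by
    have : ContDiff ℝ ∞ (deriv f) := (contDiff_infty_iff_deriv.1 hf).2
    fun_prop
  refine ⟨fun y => ∫ t in (0 : ℝ)..1, ((t ^ 0 : ℝ) : ℂ) * deriv f (y₀ + t * (y - y₀)), ?_, ?_, ?_⟩
  · exact (contDiff_integral_pow_smul hg 0).comp (contDiff_id.sub contDiff_const)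
  · intro y
    have hd (t : ℝ) (_ : t ∈ Set.uIcc (0 : ℝ) 1) :
        HasDerivAt (fun t : ℝ => f (y₀ + t * (y - y₀)))
          (((y - y₀ : ℝ) : ℂ) * deriv f (y₀ + t * (y - y₀))) t := by
      have h1 : HasDerivAt f (deriv f (y₀ + t * (y - y₀))) (y₀ + t * (y - y₀)) :=
        (hf.differentiable (by simp) _).hasDerivAt
      have h2 : HasDerivAt (fun t : ℝ => y₀ + t * (y - y₀)) (y - y₀) t := by
        simpa using ((hasDerivAt_id t).mul_const (y - y₀)).const_add y₀
      refine (h1.scomp t h2).congr_deriv ?_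
      simp only [Complex.real_smul]
    have hc : Continuous (deriv f) := hf.continuous_deriv (by simp)
    have := intervalIntegral.integral_eq_sub_of_hasDerivAt hd
      ((by fun_prop : Continuous fun t : ℝ => ((y - y₀ : ℝ) : ℂ) *
        deriv f (y₀ + t * (y - y₀))).intervalIntegrable _ _)
    rw [intervalIntegral.integral_const_mul] at this
    simpa [h0] using this.symm
  · simp

/-- A bump function extends `f` smoothly to the line without changing it near `y₀`, at the price of
a smaller ball. -/
theorem exists_smooth_quotient_ball {f : ℝ → ℂ} {y₀ ε : ℝ} (hε : 0 < ε)
    (hf : ContDiffOn ℝ ∞ f (ball y₀ ε)) (h0 : f y₀ = 0) :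
    ∃ ε' > 0, ε' ≤ ε ∧ ∃ h : ℝ → ℂ, ContDiff ℝ ∞ h ∧
      (∀ y ∈ ball y₀ ε', f y = ((y - y₀ : ℝ) : ℂ) * h y) ∧ h y₀ = deriv f y₀ := by
  let b : ContDiffBump y₀ := ⟨ε / 3, ε / 2, by positivity, by linarith⟩
  have hF : ContDiff ℝ ∞ (fun y => (b y : ℝ) • f y) := by
    rw [contDiff_iff_contDiffAt]
    intro y
    by_cases hy : y ∈ ball y₀ ε
    · exact b.contDiff.contDiffAt.smul (hf.contDiffAt (isOpen_ball.mem_nhds hy))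
    · have : (fun y => (b y : ℝ) • f y) =ᶠ[𝓝 y] fun _ => 0 := by
        have h1 : y ∈ (closedBall y₀ (ε / 2))ᶜ := fun h => hy
          (closedBall_subset_ball (by linarith) h)
        filter_upwards [isClosed_closedBall.isOpen_compl.mem_nhds h1] with x hx
        rw [b.zero_of_le_dist, zero_smul]
        exact (not_le.1 fun h => hx (mem_closedBall.2 h)).le
      exact contDiffAt_const.congr_of_eventuallyEq this
  have heq (y) (hy : y ∈ ball y₀ (ε / 3)) : (b y : ℝ) • f y = f y := by
    rw [b.one_of_mem_closedBall (ball_subset_closedBall hy), one_smul]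
  obtain ⟨h, hh, he, hd⟩ := exists_smooth_quotient hF y₀ (by simp [h0])
  refine ⟨ε / 3, by positivity, by linarith, h, hh, fun y hy => ?_, ?_⟩
  · rw [← he, heq y hy]
  · rw [hd]
    apply EventuallyEq.deriv_eq
    filter_upwards [ball_mem_nhds y₀ (by positivity : 0 < ε / 3)] with y hy using heq y hy

/-- Near `x₀` the quotient `f / f x₀` stays in the slit plane, where the logarithm is smooth; its
imaginary part corrects the constant argument of `f x₀`. -/
theorem exists_smooth_arg {E : Type*} [NormedAddCommGroup E] [NormedSpace ℝ E] {f : E → ℂ} {U : Set E}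
    (hU : IsOpen U) {x₀ : E} (hx : x₀ ∈ U)
    (hf : ContDiffOn ℝ ∞ f U) (h0 : f x₀ ≠ 0) :
    ∃ V ⊆ U, IsOpen V ∧ x₀ ∈ V ∧ ∃ θ : E → ℝ, ContDiffOn ℝ ∞ θ V ∧
      ∀ x ∈ V, f x ≠ 0 ∧ f x = (‖f x‖ : ℂ) * Complex.exp (θ x * Complex.I) := by
  have hq : ContDiffOn ℝ ∞ (fun x => f x / f x₀) U := hf.div_const _
  refine ⟨U ∩ (fun x => f x / f x₀) ⁻¹' Complex.slitPlane, Set.inter_subset_left,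
    hq.continuousOn.isOpen_inter_preimage hU Complex.isOpen_slitPlane,
    ⟨hx, by simp [h0, Complex.one_mem_slitPlane]⟩,
    fun x => (f x₀).arg + (Complex.log (f x / f x₀)).im, ?_, ?_⟩
  · refine contDiffOn_const.add fun x hx' => ?_
    have h1 : ContDiffAt ℝ ∞ Complex.log (f x / f x₀) :=
      (Complex.contDiffAt_log hx'.2).restrict_scalars ℝ
    exact Complex.imCLM.contDiff.contDiffAt.comp_contDiffWithinAt x
      (h1.comp_contDiffWithinAt x ((hq x hx'.1).mono Set.inter_subset_left))
  · intro x hx'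
    have hx0 : f x / f x₀ ≠ 0 := Complex.slitPlane_ne_zero hx'.2
    have hfx : f x ≠ 0 := fun h => hx0 (by simp [h])
    refine ⟨hfx, ?_⟩
    simp only [Complex.log_im]
    push_cast
    rw [add_mul, Complex.exp_add]
    have e1 := Complex.norm_mul_exp_arg_mul_I (f x₀)
    have e2 := Complex.norm_mul_exp_arg_mul_I (f x / f x₀)
    have hn : (‖f x₀‖ : ℂ) ≠ 0 := by exact_mod_cast norm_ne_zero_iff.2 h0
    rw [norm_div] at e2
    push_cast at e2
    have e3 : Complex.exp ((f x₀).arg * Complex.I) = f x₀ / ‖f x₀‖ := by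
      rw [eq_div_iff hn, mul_comm]; exact e1
    rw [e3, mul_comm (f x₀ / ‖f x₀‖ : ℂ), ← mul_assoc]
    field_simp at e2 ⊢
    linear_combination (-1 : ℂ) * e2

/-! ### Polar coordinates along curves in SU(1,1) -/

theorem hasDerivAt_polar_cosh {ξ θ : ℝ → ℝ} {ξ' θ' y : ℝ} (hξ : HasDerivAt ξ ξ' y)
    (hθ : HasDerivAt θ θ' y) :
    HasDerivAt (fun y => (Real.cosh (ξ y) : ℂ) * Complex.exp (θ y * Complex.I))
      (((Real.sinh (ξ y) * ξ' : ℝ) : ℂ) * Complex.exp (θ y * Complex.I) +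
        Real.cosh (ξ y) * (Complex.exp (θ y * Complex.I) * (θ' * Complex.I))) y :=
  (((Real.hasDerivAt_cosh _).comp y hξ).ofReal_comp).mul ((hθ.ofReal_comp.mul_const Complex.I).cexp)

theorem hasDerivAt_polar_sinh {ξ θ : ℝ → ℝ} {ξ' θ' y : ℝ} (hξ : HasDerivAt ξ ξ' y)
    (hθ : HasDerivAt θ θ' y) :
    HasDerivAt (fun y => (Real.sinh (ξ y) : ℂ) * Complex.exp (θ y * Complex.I))
      (((Real.cosh (ξ y) * ξ' : ℝ) : ℂ) * Complex.exp (θ y * Complex.I) +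
        Real.sinh (ξ y) * (Complex.exp (θ y * Complex.I) * (θ' * Complex.I))) y :=
  (((Real.hasDerivAt_sinh _).comp y hξ).ofReal_comp).mul ((hθ.ofReal_comp.mul_const Complex.I).cexp)

/-- The contact form of `SU(1,1)` in polar coordinates. -/
theorem polar_contact (c s θ₂ θ₃ c' s' θ₂' θ₃' : ℝ) (h : c * c' = s * s') :
    conj ((c : ℂ) * Complex.exp (θ₂ * Complex.I)) * ((c' : ℂ) * Complex.exp (θ₂ * Complex.I) +
        c * (Complex.exp (θ₂ * Complex.I) * (θ₂' * Complex.I))) -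
      (s : ℂ) * Complex.exp (θ₃ * Complex.I) * conj ((s' : ℂ) * Complex.exp (θ₃ * Complex.I) +
        s * (Complex.exp (θ₃ * Complex.I) * (θ₃' * Complex.I))) =
      ((c ^ 2 * θ₂' + s ^ 2 * θ₃' : ℝ) : ℂ) * Complex.I := by
  have h2 := norm_expI θ₂
  have h3 := norm_expI θ₃
  have hc : (c * c' : ℂ) = s * s' := by exact_mod_cast h
  simp only [map_add, map_mul, Complex.conj_ofReal, Complex.conj_I]
  push_cast
  linear_combination (c * c' + c ^ 2 * θ₂' * Complex.I) * h2 -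
    (s * s' - s ^ 2 * θ₃' * Complex.I) * h3 + hc

/-- A smooth curve in `SU(1,1)` tangent to the contact distribution, written in polar coordinates. -/
theorem exists_polar {z w : ℝ → ℂ} {y₀ ε : ℝ} (hε : 0 < ε)
    (hz : ContDiffOn ℝ ∞ z (ball y₀ ε)) (hw : ContDiffOn ℝ ∞ w (ball y₀ ε))
    (hzw : ∀ y ∈ ball y₀ ε, z y * conj (z y) - w y * conj (w y) = 1)
    (hc : ∀ y ∈ ball y₀ ε, conj (z y) * deriv z y - w y * conj (deriv w y) = 0)
    (h0 : w y₀ = 0 → deriv w y₀ ≠ 0) :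
    ∃ ε' > 0, ε' ≤ ε ∧ ∃ ξ₁ ξ₂ ξ₃ : ℝ → ℝ, IsAdmissible (ball y₀ ε') ξ₁ ξ₂ ξ₃ ∧
      ∀ y ∈ ball y₀ ε', z y = Real.cosh (ξ₁ y) * Complex.exp (ξ₂ y * Complex.I) ∧
        w y = Real.sinh (ξ₁ y) * Complex.exp (ξ₃ y * Complex.I) := by
  have hn (y) (hy : y ∈ ball y₀ ε) : ‖z y‖ ^ 2 = 1 + ‖w y‖ ^ 2 := by
    have := hzw y hy
    rw [Complex.mul_conj, Complex.mul_conj, Complex.normSq_eq_norm_sq,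
      Complex.normSq_eq_norm_sq] at this
    have h2 : ‖z y‖ ^ 2 - ‖w y‖ ^ 2 = 1 := by exact_mod_cast this
    linarith
  -- factor `w` through a nowhere vanishing function
  have hfac : ∃ ε₁ > 0, ε₁ ≤ ε ∧ ∃ (ρ : ℝ → ℝ) (h : ℝ → ℂ), ContDiffOn ℝ ∞ ρ (ball y₀ ε₁) ∧
      ContDiffOn ℝ ∞ h (ball y₀ ε₁) ∧ h y₀ ≠ 0 ∧ ∀ y ∈ ball y₀ ε₁, w y = ρ y * h y := by
    -- The argument of `w` is singular where `w` vanishes. There `w` has a simple zero by `h0`, so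
    -- Hadamard's lemma extracts the real factor `y - y₀` and leaves a function with a smooth
    -- argument.
    by_cases hw0 : w y₀ = 0
    · obtain ⟨ε₁, h1, h2, h, h3, h4, h5⟩ := exists_smooth_quotient_ball hε hw hw0
      exact ⟨ε₁, h1, h2, fun y => y - y₀, h, (contDiff_id.sub contDiff_const).contDiffOn,
        h3.contDiffOn, h5 ▸ h0 hw0, h4⟩
    · exact ⟨ε, hε, le_rfl, fun _ => 1, w, contDiffOn_const, hw, hw0, by simp⟩
  obtain ⟨ε₁, hε₁, hle, ρ, h, hρ, hh, hh0, hwρ⟩ := hfac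
  have hz0 : z y₀ ≠ 0 := by
    intro h
    have := hn y₀ (mem_ball_self hε)
    rw [h, norm_zero] at this
    nlinarith [sq_nonneg ‖w y₀‖]
  obtain ⟨V₁, hV₁, hV₁o, hyV₁, θ₁, hθ₁, hz'⟩ :=
    exists_smooth_arg isOpen_ball (mem_ball_self hε) hz hz0
  obtain ⟨V₂, hV₂, hV₂o, hyV₂, θ₂, hθ₂, hh'⟩ :=
    exists_smooth_arg isOpen_ball (mem_ball_self hε₁) hh hh0
  obtain ⟨ε', hε', hsub⟩ := Metric.isOpen_iff.1 (hV₁o.inter hV₂o) y₀ ⟨hyV₁, hyV₂⟩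
  set r := min ε' ε₁ with hr
  have hr0 : 0 < r := lt_min hε' hε₁
  have hs1 : ball y₀ r ⊆ V₁ := fun y hy => (hsub (ball_subset_ball (min_le_left _ _) hy)).1
  have hs2 : ball y₀ r ⊆ V₂ := fun y hy => (hsub (ball_subset_ball (min_le_left _ _) hy)).2
  have hs3 : ball y₀ r ⊆ ball y₀ ε₁ := ball_subset_ball (min_le_right _ _)
  have hs4 : ball y₀ r ⊆ ball y₀ ε := hs3.trans (ball_subset_ball hle)
  -- The signed factor `ρ` goes into `ξ₁`, whose hyperbolic sine may change sign; this keeps both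
  -- `ξ₁` and the argument smooth across a zero of `w`.
  obtain ⟨ξ, hξ⟩ : ∃ ξ : ℝ → ℝ, ξ = fun y => Real.arsinh (ρ y * ‖h y‖) := ⟨_, rfl⟩
  have hrep (y) (hy : y ∈ ball y₀ r) :
      z y = Real.cosh (ξ y) * Complex.exp (θ₁ y * Complex.I) ∧
        w y = Real.sinh (ξ y) * Complex.exp (θ₂ y * Complex.I) := by
    simp only [hξ]
    have hw1 := hwρ y (hs3 hy)
    constructor
    · have : ‖z y‖ = √(1 + (ρ y * ‖h y‖) ^ 2) := by
        rw [eq_comm, Real.sqrt_eq_iff_mul_self_eq (by positivity) (norm_nonneg _), ← sq,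
          hn y (hs4 hy), hw1, norm_mul, Complex.norm_real, mul_pow, mul_pow, Real.norm_eq_abs,
          sq_abs]
      rw [Real.cosh_arsinh, ← this]
      exact (hz' y (hs1 hy)).2
    · rw [Real.sinh_arsinh, hw1]
      conv_lhs => rw [(hh' y (hs2 hy)).2]
      push_cast; ring
  have s1 : ContDiffOn ℝ ∞ ξ (ball y₀ r) := by
    rw [hξ]
    exact ((hρ.mono hs3).mul ((hh.mono hs3).norm ℝ fun y hy => (hh' y (hs2 hy)).1)).arsinh
  clear hξ
  refine ⟨r, hr0, (min_le_right _ _).trans hle, _, θ₁, θ₂, ⟨isOpen_ball,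
    (convex_ball y₀ r).ordConnected, s1, hθ₁.mono hs1, hθ₂.mono hs2, ?_⟩, hrep⟩
  intro y hy
  have hnhd : ball y₀ r ∈ 𝓝 y := isOpen_ball.mem_nhds hy
  have d1 : HasDerivAt ξ (deriv ξ y) y :=
    ((s1.contDiffAt hnhd).differentiableAt (by simp)).hasDerivAt
  have d2 : HasDerivAt θ₁ (deriv θ₁ y) y :=
    (((hθ₁.mono hs1).contDiffAt hnhd).differentiableAt (by simp)).hasDerivAt
  have d3 : HasDerivAt θ₂ (deriv θ₂ y) y :=
    (((hθ₂.mono hs2).contDiffAt hnhd).differentiableAt (by simp)).hasDerivAt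
  have dz := (hasDerivAt_polar_cosh d1 d2).congr_of_eventuallyEq
    (Filter.mem_of_superset hnhd fun x hx => (hrep x hx).1)
  have dw := (hasDerivAt_polar_sinh d1 d3).congr_of_eventuallyEq
    (Filter.mem_of_superset hnhd fun x hx => (hrep x hx).2)
  have key := hc y (hs4 hy)
  rw [dz.deriv, dw.deriv, (hrep y hy).1, (hrep y hy).2, polar_contact _ _ _ _ _ _ _ _ (by ring)] at key
  rw [mul_eq_zero, or_iff_left Complex.I_ne_zero] at key
  exact_mod_cast key

/-! ### Maps tangent to a contact distribution, and the coordinates `(s, y)` -/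

/-- The integrability condition: if the one-form `B(g, dg)` vanishes, so does its exterior
derivative. Differentiating and exchanging `v` with `v'`, the second derivatives cancel by symmetry.
-/
theorem bilin_fderiv_symm {E V G : Type*} [NormedAddCommGroup E] [NormedSpace ℝ E]
    [NormedAddCommGroup V] [NormedSpace ℝ V] [NormedAddCommGroup G] [NormedSpace ℝ G]
    (B : V →L[ℝ] V →L[ℝ] G) {U : Set E} (hU : IsOpen U) {g : E → V} (hg : ContDiffOn ℝ ∞ g U)
    (h : ∀ x ∈ U, ∀ v, B (g x) (fderiv ℝ g x v) = 0) {x : E} (hx : x ∈ U) (v v' : E) :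
    B (fderiv ℝ g x v) (fderiv ℝ g x v') = B (fderiv ℝ g x v') (fderiv ℝ g x v) := by
  have hgx : ContDiffAt ℝ ∞ g x := hg.contDiffAt (hU.mem_nhds hx)
  have h1 : HasFDerivAt g (fderiv ℝ g x) x := (hgx.differentiableAt (by simp)).hasFDerivAt
  have h2 : HasFDerivAt (fderiv ℝ g) (fderiv ℝ (fderiv ℝ g) x) x :=
    ((hgx.fderiv_right (m := ∞) (by simp)).differentiableAt (by simp)).hasFDerivAt
  have hsymm : IsSymmSndFDerivAt ℝ g x := hgx.isSymmSndFDerivAt (by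
    rw [minSmoothness_of_isRCLikeNormedField]; exact WithTop.coe_le_coe.2 le_top)
  have key (u v : E) :
      B (g x) (fderiv ℝ (fderiv ℝ g) x v u) + B (fderiv ℝ g x v) (fderiv ℝ g x u) = 0 := by
    have h3 : HasFDerivAt (fun y => fderiv ℝ g y u)
        ((ContinuousLinearMap.apply ℝ V u).comp (fderiv ℝ (fderiv ℝ g) x)) x :=
      (ContinuousLinearMap.apply ℝ V u).hasFDerivAt.comp x h2
    have h4 := B.hasFDerivAt_of_bilinear h1 h3
    have h5 : (fun y => B (g y) (fderiv ℝ g y u)) =ᶠ[𝓝 x] fun _ => 0 := by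
      filter_upwards [hU.mem_nhds hx] with y hy using h y hy u
    have h6 := h4.unique ((hasFDerivAt_const (0 : G) x).congr_of_eventuallyEq h5)
    simpa using congrArg (fun L => L v) h6
  have e1 := key v v'
  have e2 := key v' v
  rw [hsymm v' v] at e1
  exact add_left_cancel (e2.trans e1.symm)

/-- The inverse function theorem at `x₀`, with the target shrunk to a ball so that segments in it
are available later. Injectivity of the derivative on all of `U` makes the inverse smooth on the
whole target. -/
theorem exists_ball_chart {E : Type*} [NormedAddCommGroup E] [NormedSpace ℝ E]
    [FiniteDimensional ℝ E] {U : Set E} (hU : IsOpen U) {x₀ : E} (hx : x₀ ∈ U)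
    {Φ : E → E} (hΦ : ContDiffOn ℝ ∞ Φ U) (hinj : ∀ x ∈ U, Function.Injective (fderiv ℝ Φ x)) :
    ∃ ψ : OpenPartialHomeomorph E E, (ψ : E → E) = Φ ∧ x₀ ∈ ψ.source ∧ ψ.source ⊆ U ∧
      ContDiffOn ℝ ∞ ψ.symm ψ.target ∧ ∃ ε > 0, ψ.target = ball (Φ x₀) ε := by
  have : CompleteSpace E := FiniteDimensional.complete ℝ E
  have hat (x) (hx : x ∈ U) : ContDiffAt ℝ ∞ Φ x := hΦ.contDiffAt (hU.mem_nhds hx)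
  have heq (x) (hx : x ∈ U) : ∃ e : E ≃L[ℝ] E, HasFDerivAt Φ (e : E →L[ℝ] E) x := by
    refine ⟨(LinearEquiv.ofInjectiveEndo (fderiv ℝ Φ x : E →ₗ[ℝ] E)
      (hinj x hx)).toContinuousLinearEquiv, ?_⟩
    refine ((hat x hx).differentiableAt (by simp)).hasFDerivAt.congr_fderiv ?_
    ext v; rfl
  obtain ⟨e₀, he₀⟩ := heq x₀ hx
  set ψ₀ := (hat x₀ hx).toOpenPartialHomeomorph Φ he₀ (by simp) with hψ₀
  have hcoe : (ψ₀ : E → E) = Φ := rfl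
  have hmem : x₀ ∈ ψ₀.source := (hat x₀ hx).mem_toOpenPartialHomeomorph_source he₀ (by simp)
  set ψ₁ := ψ₀.restrOpen U hU with hψ₁
  have hs1 : ψ₁.source = ψ₀.source ∩ U := rfl
  have hmem1 : x₀ ∈ ψ₁.source := ⟨hmem, hx⟩
  have ht1 : Φ x₀ ∈ ψ₁.target := ψ₁.map_source hmem1
  obtain ⟨ε, hε, hball⟩ := Metric.isOpen_iff.1 ψ₁.open_target _ ht1
  set ψ := (ψ₁.symm.restrOpen (ball (Φ x₀) ε) isOpen_ball).symm with hψ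
  have htar : ψ.target = ball (Φ x₀) ε := by
    change ψ₁.target ∩ ball (Φ x₀) ε = _
    exact Set.inter_eq_right.2 hball
  have hsrc : ψ.source ⊆ ψ₁.source := by
    intro x hx
    have h1 : ψ x ∈ ψ.target := ψ.map_source hx
    rw [htar] at h1
    have h2 := ψ₁.map_target (hball h1)
    have h3 : ψ₁.symm (ψ x) = x := ψ.left_inv hx
    rwa [h3] at h2
  refine ⟨ψ, rfl, ?_, fun x hx => (hsrc hx).2, ?_, ε, hε, htar⟩
  · have : ψ.symm (Φ x₀) ∈ ψ.source := ψ.map_target (by rw [htar]; exact mem_ball_self hε)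
    have h3 : ψ.symm (Φ x₀) = x₀ := ψ₁.left_inv hmem1
    rwa [h3] at this
  · intro p hp
    obtain ⟨e, he⟩ := heq (ψ.symm p) (hsrc (ψ.map_target hp)).2
    exact (ψ.contDiffAt_symm hp he (hat _ (hsrc (ψ.map_target hp)).2)).contDiffWithinAt

/-- Contact vectors at `(z, w)` have the form `(w m̄, z m)` with `m` complex. The integrability
relation `hs` says that `m m̄'` is real, so two such vectors are real-proportional; a real
functional nonzero on the second and zero on the first forces the first to vanish. -/
theorem eq_zero_of_contact {a b z w dz dw dz' dw' : ℂ} (h : z * conj z - w * conj w = 1)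
    (hc : conj z * dz - w * conj dw = 0) (hc' : conj z * dz' - w * conj dw' = 0)
    (hs : conj dz * dz' - dw * conj dw' = conj dz' * dz - dw' * conj dw)
    (h0 : (a * dz + b * dw).re = 0) (h1 : (a * dz' + b * dw').re ≠ 0) : dz = 0 ∧ dw = 0 := by
  obtain ⟨m, hm⟩ : ∃ m, m = conj z * dw - w * conj dz := ⟨_, rfl⟩
  obtain ⟨m', hm'⟩ : ∃ m', m' = conj z * dw' - w * conj dz' := ⟨_, rfl⟩
  have conj1 := congrArg conj hc
  have conj2 := congrArg conj hc'
  simp only [map_sub, map_mul, Complex.conj_conj, map_zero] at conj1 conj2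
  have e1 : dw = z * m := by rw [hm]; linear_combination -dw * h + w * conj1
  have e2 : dz = w * conj m := by
    rw [hm]; simp only [map_sub, map_mul, Complex.conj_conj]
    linear_combination -dz * h + z * hc
  have e1' : dw' = z * m' := by rw [hm']; linear_combination -dw' * h + w * conj2
  have e2' : dz' = w * conj m' := by
    rw [hm']; simp only [map_sub, map_mul, Complex.conj_conj]
    linear_combination -dz' * h + z * hc'
  have hreal : m * conj m' = m' * conj m := by
    rw [e1, e2, e1', e2'] at hs
    simp only [map_mul, Complex.conj_conj] at hs
    linear_combination (-m * conj m' + m' * conj m) * h - hs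
  have him : (m * conj m').im = 0 := by
    have := congrArg Complex.im hreal
    simp at this ⊢
    linarith
  obtain ⟨t, ht⟩ : ∃ t : ℝ, m * conj m' = t :=
    ⟨(m * conj m').re, Complex.ext (by simp) (by rw [him]; simp)⟩
  have hm0 : m' ≠ 0 := by
    rintro rfl
    simp [e1', e2'] at h1
  have e3 : m * (Complex.normSq m' : ℂ) = t * m' := by
    rw [← Complex.mul_conj, ← ht]; ring
  have e3' : conj m * (Complex.normSq m' : ℂ) = t * conj m' := by
    simpa using congrArg conj e3
  have e4 : ((Complex.normSq m' : ℝ) : ℂ) * (a * dz + b * dw) = (t : ℂ) * (a * dz' + b * dw') := by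
    rw [e1, e2, e1', e2']
    linear_combination a * w * e3' + b * z * e3
  have e5 := congrArg Complex.re e4
  rw [Complex.re_ofReal_mul, Complex.re_ofReal_mul, h0, mul_zero, eq_comm, mul_eq_zero,
    or_iff_left h1] at e5
  have hm1 : m = 0 := by
    rw [e5, Complex.ofReal_zero, zero_mul, mul_eq_zero] at e3
    exact e3.resolve_right (by exact_mod_cast (Complex.normSq_pos.2 hm0).ne')
  simp [e1, e2, hm1]

/-- Real bilinear form giving the contact form `z̄ dz - w dw̄` when evaluated on a point and a
velocity, so that `bilin_fderiv_symm` applies. -/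
abbrev contactBilin : (ℂ × ℂ) →L[ℝ] (ℂ × ℂ) →L[ℝ] ℂ :=
  (ContinuousLinearMap.mul ℝ ℂ).bilinearComp
      ((Complex.conjCLE : ℂ →L[ℝ] ℂ).comp (ContinuousLinearMap.fst ℝ ℂ ℂ))
      (ContinuousLinearMap.fst ℝ ℂ ℂ) -
    (ContinuousLinearMap.mul ℝ ℂ).bilinearComp (ContinuousLinearMap.snd ℝ ℂ ℂ)
      ((Complex.conjCLE : ℂ →L[ℝ] ℂ).comp (ContinuousLinearMap.snd ℝ ℂ ℂ))

theorem contact_symm {E : Type*} [NormedAddCommGroup E] [NormedSpace ℝ E] {U : Set E}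
    (hU : IsOpen U) {z w : E → ℂ} (hz : ContDiffOn ℝ ∞ z U) (hw : ContDiffOn ℝ ∞ w U)
    (hc : ∀ x ∈ U, ∀ v, conj (z x) * fderiv ℝ z x v - w x * conj (fderiv ℝ w x v) = 0)
    {x : E} (hx : x ∈ U) (v v' : E) :
    conj (fderiv ℝ z x v) * fderiv ℝ z x v' - fderiv ℝ w x v * conj (fderiv ℝ w x v') =
      conj (fderiv ℝ z x v') * fderiv ℝ z x v - fderiv ℝ w x v' * conj (fderiv ℝ w x v) := by
  have hf (x) (hx : x ∈ U) : fderiv ℝ (fun x => (z x, w x)) x =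
      (fderiv ℝ z x).prod (fderiv ℝ w x) :=
    (((hz.contDiffAt (hU.mem_nhds hx)).differentiableAt (by simp)).hasFDerivAt.prodMk
      ((hw.contDiffAt (hU.mem_nhds hx)).differentiableAt (by simp)).hasFDerivAt).fderiv
  have := bilin_fderiv_symm contactBilin hU (hz.prodMk hw)
    (fun x hx v => by rw [hf x hx]; simpa using hc x hx v) hx v v'
  rw [hf x hx] at this
  simpa using this

theorem eq_of_fderiv_apply_eq_zero {E F : Type*} [NormedAddCommGroup E] [NormedSpace ℝ E]
    [NormedAddCommGroup F] [NormedSpace ℝ F] {C : Set E} (hC : Convex ℝ C) {G : E → F}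
    (hG : ∀ x ∈ C, DifferentiableAt ℝ G x) {p q : E} (hp : p ∈ C) (hq : q ∈ C)
    (h : ∀ x ∈ C, fderiv ℝ G x (q - p) = 0) : G p = G q := by
  have hd (t : ℝ) (ht : t ∈ Set.Icc (0 : ℝ) 1) :
      HasDerivWithinAt (fun t : ℝ => G (p + t • (q - p))) 0 (Set.Icc 0 1) t := by
    have hmem : p + t • (q - p) ∈ C := hC.add_smul_sub_mem hp hq ht
    have h2 : HasDerivAt (fun t : ℝ => p + t • (q - p)) (q - p) t := by
      simpa using ((hasDerivAt_id t).smul_const (q - p)).const_add p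
    have := (hG _ hmem).hasFDerivAt.comp_hasDerivAt t h2
    rw [h _ hmem] at this
    exact this.hasDerivWithinAt
  have := (convex_Icc (0 : ℝ) 1).norm_image_sub_le_of_norm_hasDerivWithin_le (C := 0)
    hd (by simp) (Set.left_mem_Icc.2 zero_le_one) (Set.right_mem_Icc.2 zero_le_one)
  simp only [zero_smul, add_zero, one_smul, zero_mul, norm_le_zero_iff, sub_eq_zero,
    add_sub_cancel] at this
  exact this.symm

/-- Since `(s, z, w)` is an immersion of a surface while `(z, w)` kills the contact form, a real
linear function `y` of `(z, w)` completes `s` to local coordinates, and `z`, `w` are functions of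
`y` alone. -/
theorem exists_polar_chart {U : Set (EuclideanSpace ℝ (Fin 2))} (hU : IsOpen U)
    {x₀ : EuclideanSpace ℝ (Fin 2)} (hx₀ : x₀ ∈ U)
    {s : EuclideanSpace ℝ (Fin 2) → ℝ} {z w : EuclideanSpace ℝ (Fin 2) → ℂ}
    (hs : ContDiffOn ℝ ∞ s U) (hz : ContDiffOn ℝ ∞ z U) (hw : ContDiffOn ℝ ∞ w U)
    (hzw : ∀ x ∈ U, z x * conj (z x) - w x * conj (w x) = 1)
    (hc : ∀ x ∈ U, ∀ v, conj (z x) * fderiv ℝ z x v - w x * conj (fderiv ℝ w x v) = 0)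
    (hinj : ∀ x ∈ U, ∀ v, fderiv ℝ s x v = 0 → fderiv ℝ z x v = 0 → fderiv ℝ w x v = 0 → v = 0) :
    ∃ φ : OpenPartialHomeomorph (EuclideanSpace ℝ (Fin 2)) (EuclideanSpace ℝ (Fin 2)),
      x₀ ∈ φ.source ∧ φ.source ⊆ U ∧ ContDiffOn ℝ ∞ φ φ.source ∧
      ContDiffOn ℝ ∞ φ.symm φ.target ∧ ∃ (I : Set ℝ) (ξ₁ ξ₂ ξ₃ : ℝ → ℝ),
        IsAdmissible I ξ₁ ξ₂ ξ₃ ∧ ∀ x ∈ φ.source, φ x 0 = s x ∧ φ x 1 ∈ I ∧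
          z x = Real.cosh (ξ₁ (φ x 1)) * Complex.exp (ξ₂ (φ x 1) * Complex.I) ∧
          w x = Real.sinh (ξ₁ (φ x 1)) * Complex.exp (ξ₃ (φ x 1) * Complex.I) := by
  have dats (x) (hx : x ∈ U) : HasFDerivAt s (fderiv ℝ s x) x :=
    ((hs.contDiffAt (hU.mem_nhds hx)).differentiableAt (by simp)).hasFDerivAt
  have datz (x) (hx : x ∈ U) : HasFDerivAt z (fderiv ℝ z x) x :=
    ((hz.contDiffAt (hU.mem_nhds hx)).differentiableAt (by simp)).hasFDerivAt
  have datw (x) (hx : x ∈ U) : HasFDerivAt w (fderiv ℝ w x) x :=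
    ((hw.contDiffAt (hU.mem_nhds hx)).differentiableAt (by simp)).hasFDerivAt
  -- a transverse coordinate which is a linear function of `z` and `w`
  obtain ⟨v₀, hv₀, hsv₀⟩ : ∃ v₀ : EuclideanSpace ℝ (Fin 2), v₀ ≠ 0 ∧ fderiv ℝ s x₀ v₀ = 0 := by
    have hni : ¬ Function.Injective (fderiv ℝ s x₀ : EuclideanSpace ℝ (Fin 2) →ₗ[ℝ] ℝ) := by
      intro h
      have := LinearMap.finrank_le_finrank_of_injective h
      simp at this
    rw [← LinearMap.ker_eq_bot, Submodule.eq_bot_iff] at hni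
    push Not at hni
    obtain ⟨v, h1, h2⟩ := hni
    exact ⟨v, h2, h1⟩
  -- Whichever of `dz v₀`, `dw v₀` is nonzero is paired with its own conjugate, which gives a
  -- positive number.
  obtain ⟨a, b, hab⟩ : ∃ a b : ℂ, (a * fderiv ℝ z x₀ v₀ + b * fderiv ℝ w x₀ v₀).re ≠ 0 := by
    have hpos (c : ℂ) (h : c ≠ 0) : (conj c * c).re ≠ 0 := by
      rw [mul_comm, Complex.mul_conj, Complex.ofReal_re]
      exact (Complex.normSq_pos.2 h).ne'
    by_cases h : fderiv ℝ z x₀ v₀ = 0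
    · exact ⟨0, conj (fderiv ℝ w x₀ v₀), by
        simpa using hpos _ fun h' => hv₀ (hinj x₀ hx₀ v₀ hsv₀ h h')⟩
    · exact ⟨conj (fderiv ℝ z x₀ v₀), 0, by simpa using hpos _ h⟩
  set y : EuclideanSpace ℝ (Fin 2) → ℝ := fun x => (a * z x + b * w x).re with hy
  have hyd : ContDiffOn ℝ ∞ y U := Complex.reCLM.contDiff.comp_contDiffOn
    ((contDiffOn_const.mul hz).add (contDiffOn_const.mul hw))
  have daty (x) (hx : x ∈ U) : HasFDerivAt y (fderiv ℝ y x) x :=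
    ((hyd.contDiffAt (hU.mem_nhds hx)).differentiableAt (by simp)).hasFDerivAt
  have hyf (x) (hx : x ∈ U) (v) :
      fderiv ℝ y x v = (a * fderiv ℝ z x v + b * fderiv ℝ w x v).re := by
    have := Complex.reCLM.hasFDerivAt.comp x
      (((datz x hx).const_mul a).add ((datw x hx).const_mul b))
    rw [(daty x hx).unique this]
    simp
  set U₁ := U ∩ (fun x => fderiv ℝ y x v₀) ⁻¹' {0}ᶜ with hU₁
  have hU₁o : IsOpen U₁ := by
    refine ContinuousOn.isOpen_inter_preimage ?_ hU isOpen_compl_singleton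
    exact (hyd.continuousOn_fderiv_of_isOpen hU (by simp)).clm_apply continuousOn_const
  have hx₁ : x₀ ∈ U₁ := ⟨hx₀, by simpa [hyf x₀ hx₀] using hab⟩
  -- Wherever `dy v₀ ≠ 0`, the kernel of `dy` is contained in those of `dz` and `dw`, by comparison
  -- with the reference vector `v₀`.
  have hker (x) (hx : x ∈ U₁) (v) (hv : fderiv ℝ y x v = 0) :
      fderiv ℝ z x v = 0 ∧ fderiv ℝ w x v = 0 :=
    eq_zero_of_contact (hzw x hx.1) (hc x hx.1 v) (hc x hx.1 v₀)
      (contact_symm hU hz hw hc hx.1 v v₀) (by rw [← hyf x hx.1]; exact hv)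
      (by rw [← hyf x hx.1]; exact hx.2)
  set Φ : EuclideanSpace ℝ (Fin 2) → EuclideanSpace ℝ (Fin 2) := fun x => !₂[s x, y x] with hΦ
  have hΦd : ContDiffOn ℝ ∞ Φ U₁ := by
    rw [contDiffOn_euclidean]
    intro i
    fin_cases i
    · exact hs.mono Set.inter_subset_left
    · exact hyd.mono Set.inter_subset_left
  have hΦ0 (x) (hx : x ∈ U₁) (v) : fderiv ℝ Φ x v 0 = fderiv ℝ s x v := by
    have h1 : HasFDerivAt Φ (fderiv ℝ Φ x) x :=
      ((hΦd.contDiffAt (hU₁o.mem_nhds hx)).differentiableAt (by simp)).hasFDerivAt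
    have h2 := (EuclideanSpace.proj (𝕜 := ℝ) (0 : Fin 2)).hasFDerivAt.comp x h1
    exact congrArg (fun L => L v) (h2.unique (dats x hx.1))
  have hΦ1 (x) (hx : x ∈ U₁) (v) : fderiv ℝ Φ x v 1 = fderiv ℝ y x v := by
    have h1 : HasFDerivAt Φ (fderiv ℝ Φ x) x :=
      ((hΦd.contDiffAt (hU₁o.mem_nhds hx)).differentiableAt (by simp)).hasFDerivAt
    have h2 := (EuclideanSpace.proj (𝕜 := ℝ) (1 : Fin 2)).hasFDerivAt.comp x h1
    exact congrArg (fun L => L v) (h2.unique (daty x hx.1))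
  have hΦi (x) (hx : x ∈ U₁) : Function.Injective (fderiv ℝ Φ x) := by
    rw [injective_iff_map_eq_zero]
    intro v hv
    have e0 := hΦ0 x hx v
    have e1 := hΦ1 x hx v
    rw [hv] at e0 e1
    obtain ⟨h1, h2⟩ := hker x hx v e1.symm
    exact hinj x hx.1 v e0.symm h1 h2
  obtain ⟨ψ, hψ, hx₀ψ, hψU, hψs, ε, hε, htar⟩ := exists_ball_chart hU₁o hx₁ hΦd hΦi
  set c := Φ x₀ with hcdef
  have hsym (p) (hp : p ∈ ball c ε) : ψ.symm p ∈ U₁ ∧ Φ (ψ.symm p) = p := by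
    rw [← htar] at hp
    exact ⟨hψU (ψ.map_target hp), hψ ▸ ψ.right_inv hp⟩
  have dsym (p) (hp : p ∈ ball c ε) : HasFDerivAt ψ.symm (fderiv ℝ ψ.symm p) p := by
    rw [htar] at hψs
    exact ((hψs.contDiffAt (isOpen_ball.mem_nhds hp)).differentiableAt (by simp)).hasFDerivAt
  have hinv (p) (hp : p ∈ ball c ε) (e) :
      fderiv ℝ Φ (ψ.symm p) (fderiv ℝ ψ.symm p e) = e := by
    have h1 : HasFDerivAt Φ (fderiv ℝ Φ (ψ.symm p)) (ψ.symm p) :=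
      ((hΦd.contDiffAt (hU₁o.mem_nhds (hsym p hp).1)).differentiableAt (by simp)).hasFDerivAt
    have h2 := h1.comp p (dsym p hp)
    have h3 : HasFDerivAt (Φ ∘ ψ.symm) (ContinuousLinearMap.id ℝ _) p := by
      refine (hasFDerivAt_id p).congr_of_eventuallyEq ?_
      filter_upwards [isOpen_ball.mem_nhds hp] with q hq using (hsym q hq).2
    exact congrArg (fun L => L e) (h2.unique h3)
  have hline (t : ℝ) : dist (!₂[c 0, t] : EuclideanSpace ℝ (Fin 2)) c = dist t (c 1) := by
    rw [EuclideanSpace.dist_eq]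
    simp [Fin.sum_univ_two, Real.sqrt_sq_eq_abs, Real.dist_eq]
  have hmemline {t : ℝ} (ht : t ∈ ball (c 1) ε) :
      (!₂[c 0, t] : EuclideanSpace ℝ (Fin 2)) ∈ ball c ε := by
    rw [mem_ball, hline]; exact ht
  have hcoord {p : EuclideanSpace ℝ (Fin 2)} {r : ℝ} (hp : p ∈ ball c r) :
      p 1 ∈ ball (c 1) r := by
    rw [mem_ball] at hp ⊢
    refine lt_of_le_of_lt ?_ hp
    rw [Real.dist_eq, dist_eq_norm]
    exact PiLp.norm_apply_le (p - c) 1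
  set ℓ : ℝ → EuclideanSpace ℝ (Fin 2) := fun t => !₂[c 0, t] with hℓ
  have hℓd : ContDiff ℝ ∞ ℓ := by
    rw [contDiff_euclidean]
    intro i
    fin_cases i
    · exact contDiff_const
    · exact contDiff_id
  have hℓ' (t : ℝ) : HasDerivAt ℓ !₂[0, 1] t := by
    have h1 : ℓ = fun t => !₂[c 0, 0] + t • !₂[0, 1] := by
      ext t i; fin_cases i <;> simp [hℓ]
    rw [h1]
    simpa using ((hasDerivAt_id t).smul_const (!₂[0, 1] : EuclideanSpace ℝ (Fin 2))).const_add
      (!₂[c 0, 0] : EuclideanSpace ℝ (Fin 2))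
  have hcomp {f : EuclideanSpace ℝ (Fin 2) → ℂ} (hf : ContDiffOn ℝ ∞ f U) :
      ContDiffOn ℝ ∞ (fun t => f (ψ.symm (ℓ t))) (ball (c 1) ε) := by
    rw [htar] at hψs
    exact (hf.comp hψs fun p hp => (hsym p hp).1.1).comp hℓd.contDiffOn fun t ht => hmemline ht
  have hder {f : EuclideanSpace ℝ (Fin 2) → ℂ} (hf : ContDiffOn ℝ ∞ f U) {t : ℝ}
      (ht : t ∈ ball (c 1) ε) : deriv (fun t => f (ψ.symm (ℓ t))) t =
        fderiv ℝ f (ψ.symm (ℓ t)) (fderiv ℝ ψ.symm (ℓ t) !₂[0, 1]) := by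
    have h1 := (((hf.contDiffAt (hU.mem_nhds (hsym _ (hmemline ht)).1.1)).differentiableAt
      (by simp)).hasFDerivAt.comp _ (dsym _ (hmemline ht))).comp_hasDerivAt t (hℓ' t)
    exact h1.deriv
  -- In the coordinates `(s, y)` such a function is constant along the segment at height `p 1`
  -- joining `p` to the line `s = c 0`, and that segment stays in the ball.
  have hconst {f : EuclideanSpace ℝ (Fin 2) → ℂ} (hf : ContDiffOn ℝ ∞ f U)
      (hk : ∀ x ∈ U₁, ∀ v, fderiv ℝ y x v = 0 → fderiv ℝ f x v = 0)
      {p : EuclideanSpace ℝ (Fin 2)} (hp : p ∈ ball c ε) :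
      f (ψ.symm p) = f (ψ.symm (ℓ (p 1))) := by
    refine eq_of_fderiv_apply_eq_zero (G := fun p => f (ψ.symm p)) (convex_ball c ε) ?_ hp
      (hmemline (hcoord hp)) ?_
    · intro q hq
      exact ((hf.contDiffAt (hU.mem_nhds (hsym _ hq).1.1)).differentiableAt
        (by simp)).comp q (dsym q hq).differentiableAt
    · intro q hq
      have h1 := ((hf.contDiffAt (hU.mem_nhds (hsym _ hq).1.1)).differentiableAt
        (by simp)).hasFDerivAt.comp q (dsym q hq)
      have h2 : fderiv ℝ (fun p => f (ψ.symm p)) q = _ := h1.fderiv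
      rw [h2]
      refine hk _ (hsym q hq).1 _ ?_
      rw [← hΦ1 _ (hsym q hq).1]
      refine (congrArg (fun v : EuclideanSpace ℝ (Fin 2) => v 1) (hinv q hq _)).trans ?_
      simp [hℓ]
  have hℓc : ℓ (c 1) = c := by
    ext i; fin_cases i <;> rfl
  obtain ⟨ε', hε', hle, ξ₁, ξ₂, ξ₃, hadm, hrep⟩ := exists_polar hε (hcomp hz) (hcomp hw)
    (fun t ht => hzw _ (hsym _ (hmemline ht)).1.1)
    (fun t ht => by rw [hder hz ht, hder hw ht]; exact hc _ (hsym _ (hmemline ht)).1.1 _)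
    (by
      -- If `w` and its `y`-derivative both vanished, then `|z| = 1` and the contact equation would
      -- give `dz = 0`, contradicting that `y = Re(a z + b w)` has derivative one along the line.
      intro hw0 hw1
      have hm := mem_ball_self (x := c 1) hε
      have hxm := (hsym _ (hmemline hm)).1
      rw [hder hw hm] at hw1
      have h1 := hzw _ hxm.1
      have h2 := hc _ hxm.1 (fderiv ℝ ψ.symm (ℓ (c 1)) !₂[0, 1])
      rw [hw0] at h1 h2
      have h3 : conj (z (ψ.symm (ℓ (c 1)))) ≠ 0 := by
        intro h; rw [h] at h1; simp at h1
      rw [zero_mul, sub_zero, mul_eq_zero, or_iff_right h3] at h2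
      have h4 := hΦ1 _ hxm (fderiv ℝ ψ.symm (ℓ (c 1)) !₂[0, 1])
      rw [hinv _ (hmemline hm), hyf _ hxm.1, hw1, h2] at h4
      simp at h4)
  have hsub : ball c ε' ⊆ ball c ε := ball_subset_ball hle
  set φ := (ψ.symm.restrOpen (ball c ε') isOpen_ball).symm with hφ
  have hφt : φ.target = ball c ε' := by
    change ψ.target ∩ ball c ε' = _
    rw [htar]; exact Set.inter_eq_right.2 hsub
  have hφc : (φ : _ → _) = Φ := hψ
  have hφs : φ.source ⊆ U₁ := fun x hx => by
    have h1 := φ.map_source hx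
    rw [hφt] at h1
    have h2 := (hsym _ (hsub h1)).1
    have h3 : ψ.symm (φ x) = x := φ.left_inv hx
    rwa [h3] at h2
  refine ⟨φ, ?_, fun x hx => (hφs hx).1, ?_, ?_, ball (c 1) ε', ξ₁, ξ₂, ξ₃, hadm, ?_⟩
  · have h1 : φ.symm c ∈ φ.source := φ.map_target (by rw [hφt]; exact mem_ball_self hε')
    have h2 : φ.symm c = x₀ := by
      have : c = ψ x₀ := by rw [hψ]
      rw [this]; exact ψ.left_inv hx₀ψ
    rwa [h2] at h1
  · rw [hφc]; exact hΦd.mono hφs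
  · rw [hφt]
    rw [htar] at hψs
    exact hψs.mono hsub
  · intro x hx
    have h1 := φ.map_source hx
    rw [hφt] at h1
    have h3 : ψ.symm (φ x) = x := φ.left_inv hx
    have h4 := hrep _ (hcoord h1)
    rw [← hconst hz (fun x hx v hv => (hker x hx v hv).1) (hsub h1),
      ← hconst hw (fun x hx v hv => (hker x hx v hv).2) (hsub h1), h3] at h4
    exact ⟨by rw [hφc]; rfl, hcoord h1, h4⟩

/-! ### The slope `d` and the conormal vector `Q` -/

/-- With `b = √B`, `t = τ|ν|` and `u = √(lam + ν²)`, the definition of `B` reads `b² = t² - u²`. So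
`d = (b + t) / u` satisfies `d² = (t + b) / (t - b)`, which is the last identity, and `u < t` gives
`d > 1`. -/
theorem slope_facts {τ lam ν : ℝ} (hτ : 0 < τ) (hB : 0 < B τ lam ν) (hu : 0 < lam + ν ^ 2) :
    ν ≠ 0 ∧ 1 < slope τ lam ν ∧
      (slope τ lam ν ^ 2 + 1) * √(B τ lam ν) = τ * |ν| * (slope τ lam ν ^ 2 - 1) := by
  have hν : ν ≠ 0 := by
    rintro rfl
    simp [B] at hB hu
    linarith
  have hb : 0 < √(B τ lam ν) := Real.sqrt_pos.2 hB
  have hb2 : √(B τ lam ν) ^ 2 = (τ * |ν|) ^ 2 - (lam + ν ^ 2) := by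
    rw [Real.sq_sqrt hB.le, mul_pow, sq_abs, B]; ring
  have hu1 : 0 < √(lam + ν ^ 2) := Real.sqrt_pos.2 hu
  have hu2 : √(lam + ν ^ 2) ^ 2 = lam + ν ^ 2 := Real.sq_sqrt hu.le
  have ht : 0 < τ * |ν| := mul_pos hτ (abs_pos.2 hν)
  rw [← hu2] at hb2
  rw [slope]
  generalize √(B τ lam ν) = b at *
  generalize √(lam + ν ^ 2) = u at *
  generalize τ * |ν| = t at *
  refine ⟨hν, ?_, ?_⟩
  · rw [lt_div_iff₀ hu1]
    nlinarith
  · field_simp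
    linear_combination (b + t) * hb2

theorem g0_X1_X1 {κ : ℝ} (hκ : 0 < κ) {q : Fin 4 → ℝ} (hq : q ∈ AdS κ) :
    g0 (X1 κ q) (X1 κ q) = -1 := by
  rw [X1, g0_smul_left, g0_smul_right, g0_J1_J1, show g0 q q = -4 / κ from hq]
  have := Real.sq_sqrt hκ.le
  field_simp
  linear_combination -4 * this

theorem gτ_X1 {κ : ℝ} (hκ : 0 < κ) (τ : ℝ) {q : Fin 4 → ℝ} (hq : q ∈ AdS κ) (v : Fin 4 → ℝ) :
    gτ κ τ q v (X1 κ q) = τ ^ 2 * g0 v (X1 κ q) := by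
  rw [gτ, g0_X1_X1 hκ hq]; ring

/-- The coefficient `lam sgn(ν) / ((√κ/2) √B)`. -/
def conormalScale (κ τ lam ν : ℝ) : ℝ := lam * ν / (|ν| * (√κ / 2) * √(B τ lam ν))

/-- The coefficient `(1 - τ²) lam ν √κ / (2 τ)`. -/
def conormalShift (κ τ lam ν : ℝ) : ℝ := (1 - τ ^ 2) * lam * ν * (√κ / 2) / τ

/-- The metric dual of the normal `N`, rotated by `J₁` and rescaled to have square `-4/κ`. -/
def conormal (κ τ lam ν : ℝ) (q N : Fin 4 → ℝ) : Fin 4 → ℝ :=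
  conormalScale κ τ lam ν • (J1 *ᵥ N - conormalShift κ τ lam ν • q)

/-- `N` is a unit normal at `q` making the prescribed angle with `E₁`. -/
structure IsAngleNormal (κ τ lam ν : ℝ) (q N : Fin 4 → ℝ) : Prop where
  mem : q ∈ AdS κ
  tangent : g0 q N = 0
  unit : gτ κ τ q N N = lam
  angle : lam * gτ κ τ q N (E1 κ τ q) = ν

theorem gτ_E1 {κ τ : ℝ} (hκ : 0 < κ) (hτ : 0 < τ) {q : Fin 4 → ℝ} (hq : q ∈ AdS κ)
    (N : Fin 4 → ℝ) : gτ κ τ q N (E1 κ τ q) = τ * (√κ / 2) * g0 N (J1 *ᵥ q) := by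
  have : gτ κ τ q N (E1 κ τ q) = τ⁻¹ * gτ κ τ q N (X1 κ q) := by
    simp only [gτ, E1, g0_smul_left, g0_smul_right]; ring
  rw [this, gτ_X1 hκ τ hq, X1, g0_smul_right]
  field_simp

theorem IsAngleNormal.g0_J1 {κ τ lam ν : ℝ} (hκ : 0 < κ) (hτ : 0 < τ) (hlam : lam ^ 2 = 1)
    {q N : Fin 4 → ℝ} (h : IsAngleNormal κ τ lam ν q N) :
    τ * (√κ / 2) * g0 N (J1 *ᵥ q) = lam * ν := by
  rw [← gτ_E1 hκ hτ h.mem]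
  linear_combination lam * h.angle - gτ κ τ q N (E1 κ τ q) * hlam

theorem conormalScale_ne_zero {κ τ lam ν : ℝ} (hκ : 0 < κ) (hlam : lam ^ 2 = 1)
    (hν : ν ≠ 0) (hB : 0 < B τ lam ν) : conormalScale κ τ lam ν ≠ 0 := by
  have h1 : lam ≠ 0 := by rintro rfl; norm_num at hlam
  have h2 : √κ ≠ 0 := (Real.sqrt_pos.2 hκ).ne'
  have h3 : √(B τ lam ν) ≠ 0 := (Real.sqrt_pos.2 hB).ne'
  have h4 : |ν| ≠ 0 := abs_ne_zero.2 hν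
  unfold conormalScale
  positivity

/-- The correction term of `gτ` contributes a fixed multiple of `J1 q`, because the angle condition
fixes the vertical component of `N`. Hence the `g0`-dual of `gτ(·, N)` is `N` plus that multiple,
which is `-J1 Q` after rescaling. -/
theorem gτ_eq_conormal {κ τ lam ν : ℝ} (hτ : 0 < τ) {q N : Fin 4 → ℝ}
    (h : τ * (√κ / 2) * g0 N (J1 *ᵥ q) = lam * ν) (v : Fin 4 → ℝ) :
    conormalScale κ τ lam ν * gτ κ τ q v N =
      -g0 (J1 *ᵥ conormal κ τ lam ν q N) v := by
  rw [conormal, Matrix.mulVec_smul, Matrix.mulVec_sub, Matrix.mulVec_smul, J1_J1_mulVec,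
    g0_smul_left, g0_sub_left, g0_smul_left, gτ, X1, g0_smul_right, g0_smul_right,
    g0_comm (J1 *ᵥ q) v, conormalShift]
  have h1 : g0 (-N) v = -g0 v N := by simp [g0]; ring
  have h2 : √κ / 2 * g0 N (J1 *ᵥ q) = lam * ν / τ := by
    rw [eq_div_iff hτ.ne', ← h]; ring
  rw [h1, h2]
  ring

/-- Before rescaling, the vector has square `-B`; this explains `√B` in the scale, and the sign of
`ν` there makes `g0 q Q` negative. These products are exactly those of `r (e₁ + d e₂)` and `r (-e₁ +
d e₂)` in a Hermitian orthonormal frame. -/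
theorem conormal_facts {κ τ lam ν : ℝ} (hκ : 0 < κ) (hτ : 0 < τ) (hlam : lam ^ 2 = 1)
    (hB : 0 < B τ lam ν) (hu : 0 < lam + ν ^ 2) {q N : Fin 4 → ℝ}
    (h : IsAngleNormal κ τ lam ν q N) :
    g0 (conormal κ τ lam ν q N) (conormal κ τ lam ν q N) = -4 / κ ∧
      g0 (J1 *ᵥ q) (conormal κ τ lam ν q N) = 0 ∧
      (slope τ lam ν ^ 2 - 1) * g0 q (conormal κ τ lam ν q N) =
        (slope τ lam ν ^ 2 + 1) * (-4 / κ) := by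
  obtain ⟨hν, hd, hs⟩ := slope_facts hτ hB hu
  have hk := Real.sq_sqrt hκ.le
  have hk0 : 0 < √κ := Real.sqrt_pos.2 hκ
  have hb0 : 0 < √(B τ lam ν) := Real.sqrt_pos.2 hB
  have hb : √(B τ lam ν) ^ 2 = ν ^ 2 * (τ ^ 2 - 1) - lam := Real.sq_sqrt hB.le
  have hv0 : 0 < |ν| := abs_pos.2 hν
  have hv : |ν| ^ 2 = ν ^ 2 := sq_abs ν
  have e1 : g0 N (J1 *ᵥ q) = lam * ν / (τ * (√κ / 2)) := by
    rw [eq_div_iff (by positivity), ← h.g0_J1 hκ hτ hlam]; ring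
  have e2 : g0 N N = lam - (1 - τ ^ 2) * (lam * ν / τ) ^ 2 := by
    have := h.unit
    rw [gτ, X1, g0_smul_right, e1] at this
    rw [show √κ / 2 * (lam * ν / (τ * (√κ / 2))) = lam * ν / τ by field_simp] at this
    linear_combination this
  have e3 : g0 q q = -4 / √κ ^ 2 := by rw [hk]; exact h.mem
  have e4 : g0 (J1 *ᵥ N) q = -(lam * ν / (τ * (√κ / 2))) := by rw [g0_J1_left, e1]
  have e5 : g0 q (J1 *ᵥ N) = -(lam * ν / (τ * (√κ / 2))) := by rw [g0_comm, e4]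
  have hμ : conormalScale κ τ lam ν ^ 2 * √(B τ lam ν) ^ 2 = 4 / √κ ^ 2 := by
    rw [conormalScale]
    field_simp
    linear_combination 4 * ν ^ 2 * hlam - 4 * hv
  refine ⟨?_, ?_, ?_⟩
  · have hin : g0 (J1 *ᵥ N - conormalShift κ τ lam ν • q) (J1 *ᵥ N - conormalShift κ τ lam ν • q) =
        -√(B τ lam ν) ^ 2 := by
      simp only [g0_smul_left, g0_smul_right, g0_sub_left, g0_sub_right, g0_J1_J1, e2, e3, e4, e5]
      rw [hb, conormalShift]
      field_simp
      linear_combination 4 * (τ ^ 2 * ν ^ 2 - τ ^ 4 * ν ^ 2) * hlam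
    rw [conormal, g0_smul_left, g0_smul_right, hin, show -4 / κ = -4 / √κ ^ 2 by rw [hk]]
    linear_combination -hμ
  · simp only [conormal, g0_smul_right, g0_sub_right, g0_J1_J1, h.tangent]
    rw [g0_comm (J1 *ᵥ q) q, g0_J1_self]; ring
  · simp only [conormal, g0_smul_right, g0_sub_right, e3, e5]
    have hd2 : slope τ lam ν ^ 2 + 1 = τ * |ν| * (slope τ lam ν ^ 2 - 1) / √(B τ lam ν) := by
      rw [eq_div_iff hb0.ne', hs]
    rw [hd2, show -4 / κ = -4 / √κ ^ 2 by rw [hk], conormalScale, conormalShift]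
    field_simp
    linear_combination (-4 * τ ^ 2 * (slope τ lam ν ^ 2 - 1) * ν ^ 2) * hlam +
      4 * (slope τ lam ν ^ 2 - 1) * τ ^ 2 * hv

/-! ### Hermitian frames, and surfaces written as `A γ(s)` -/

/-- A matrix with orthonormal columns for the Hermitian form of signature (1,1) is unitary for it:
its determinant has modulus one, and its second row is determined by the first row and the
determinant. -/
theorem frame_facts {z₁ w₁ z₂ w₂ D : ℂ} (h₁ : z₁ * conj z₁ - w₁ * conj w₁ = 1)
    (h₂ : z₂ * conj z₂ - w₂ * conj w₂ = -1) (h₁₂ : z₁ * conj z₂ - w₁ * conj w₂ = 0)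
    (hD : D = z₁ * w₂ - w₁ * z₂) :
    D * conj D = 1 ∧ w₁ = D * conj z₂ ∧ w₂ = D * conj z₁ ∧ z₁ * conj z₁ - z₂ * conj z₂ = 1 := by
  have h₂₁ := congrArg conj h₁₂
  simp only [map_sub, map_mul, Complex.conj_conj, map_zero] at h₂₁
  have hDD : D * conj D = 1 := by
    rw [hD]
    simp only [map_sub, map_mul]
    linear_combination h₂₁ * (z₁ * conj z₂ - w₁ * conj w₂) - h₂ * (z₁ * conj z₁ - w₁ * conj w₁) + h₁
  have e1 : w₁ = D * conj z₂ := by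
    rw [hD]; linear_combination -w₂ * h₁₂ + w₁ * h₂
  refine ⟨hDD, e1, ?_, ?_⟩
  · rw [hD]; linear_combination -w₂ * h₁ + w₁ * h₂₁
  · have hw : w₁ * conj w₁ = z₂ * conj z₂ := by
      rw [e1]
      simp only [map_mul, Complex.conj_conj]
      linear_combination z₂ * conj z₂ * hDD
    rw [← hw, h₁]

/-- The phase of the first component of `γ` at the parameter `s`, with `a = √κ / 2`. -/
def phase₁ (a lam d s : ℝ) : ℂ := Complex.exp ((-(lam * (a * d * s)) : ℝ) * Complex.I)

/-- The phase of the second component of `γ` at the parameter `s`, with `a = √κ / 2`. -/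
def phase₂ (a lam d s : ℝ) : ℂ := Complex.exp ((lam * (a * (s / d)) : ℝ) * Complex.I)

/-- `q` is the image of `r (t e^{-iλads}, d e^{iλas/d})` under the element of `U(1,1)` with first row
`(z, w)` and determinant `δ`. -/
structure IsSpun (a lam d r t s : ℝ) (δ z w : ℂ) (q : Fin 4 → ℝ) : Prop where
  zc_eq : zc q = r * (t * (z * phase₁ a lam d s) + d * (w * phase₂ a lam d s))
  wc_eq : wc q = r * (δ * (t * (conj w * phase₁ a lam d s) + d * (conj z * phase₂ a lam d s)))

theorem zc_curve {lam : ℝ} (hlam : lam = 1 ∨ lam = -1) (κ d s : ℝ) :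
    zc (curve κ lam d s) = (2 / √κ * (1 / √(d ^ 2 - 1)) : ℝ) * phase₁ (√κ / 2) lam d s := by
  apply Complex.ext
  · rcases hlam with rfl | rfl <;>
    simp [curve, phase₁, Complex.exp_ofReal_mul_I_re, -Complex.ofReal_neg, -Complex.ofReal_mul]
  · rcases hlam with rfl | rfl <;>
    simp [curve, phase₁, Complex.exp_ofReal_mul_I_im, -Complex.ofReal_neg, -Complex.ofReal_mul]

theorem wc_curve {lam : ℝ} (hlam : lam = 1 ∨ lam = -1) (κ d s : ℝ) :
    wc (curve κ lam d s) =
      (2 / √κ * (1 / √(d ^ 2 - 1)) : ℝ) * (d * phase₂ (√κ / 2) lam d s) := by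
  apply Complex.ext
  · rcases hlam with rfl | rfl <;>
    simp [curve, phase₂, Complex.exp_ofReal_mul_I_re, -Complex.ofReal_neg, -Complex.ofReal_mul,
      -Complex.ofReal_div]
  · rcases hlam with rfl | rfl <;>
    simp [curve, phase₂, Complex.exp_ofReal_mul_I_im, -Complex.ofReal_neg, -Complex.ofReal_mul,
      -Complex.ofReal_div]

theorem isSpun_param {lam : ℝ} (hlam : lam = 1 ∨ lam = -1) (κ d ξ : ℝ) (ξ₁ ξ₂ ξ₃ : ℝ → ℝ)
    (p : EuclideanSpace ℝ (Fin 2)) :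
    IsSpun (√κ / 2) lam d (2 / √κ * (1 / √(d ^ 2 - 1))) 1 (p 0)
      (-Complex.I * Complex.exp (ξ * Complex.I))
      (Real.cosh (ξ₁ (p 1)) * Complex.exp (ξ₂ (p 1) * Complex.I))
      (Real.sinh (ξ₁ (p 1)) * Complex.exp (ξ₃ (p 1) * Complex.I))
      (param κ lam d ξ ξ₁ ξ₂ ξ₃ p) := by
  constructor
  · rw [param, zc_matA, zc_curve hlam, wc_curve hlam]; push_cast; ring
  · rw [param, wc_matA, zc_curve hlam, wc_curve hlam]; push_cast; ring

theorem IsSpun.ext {a lam d r t s : ℝ} {δ z w : ℂ} {p q : Fin 4 → ℝ}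
    (hp : IsSpun a lam d r t s δ z w p) (hq : IsSpun a lam d r t s δ z w q) : p = q :=
  ext_zc_wc (hp.zc_eq.trans hq.zc_eq.symm) (hp.wc_eq.trans hq.wc_eq.symm)

theorem norm_phase₁ (a lam d s : ℝ) : phase₁ a lam d s * conj (phase₁ a lam d s) = 1 :=
  norm_expI _

theorem norm_phase₂ (a lam d s : ℝ) : phase₂ a lam d s * conj (phase₂ a lam d s) = 1 :=
  norm_expI _

theorem hasDerivAt_phase₁ (a lam d : ℝ) {s : ℝ → ℝ} {s' x : ℝ} (hs : HasDerivAt s s' x) :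
    HasDerivAt (fun x => phase₁ a lam d (s x))
      (Complex.I * (-(lam * (a * d * s')) : ℝ) * phase₁ a lam d (s x)) x := by
  have h := (((hs.const_mul (a * d)).const_mul lam).fun_neg.ofReal_comp.mul_const Complex.I).cexp
  refine h.congr_deriv ?_
  rw [phase₁]; ring

theorem hasDerivAt_phase₂ (a lam d : ℝ) {s : ℝ → ℝ} {s' x : ℝ} (hs : HasDerivAt s s' x) :
    HasDerivAt (fun x => phase₂ a lam d (s x))
      (Complex.I * (lam * (a * (s' / d)) : ℝ) * phase₂ a lam d (s x)) x := by
  have h := ((((hs.div_const d).const_mul a).const_mul lam).ofReal_comp.mul_const Complex.I).cexp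
  refine h.congr_deriv ?_
  rw [phase₂]; ring

theorem hasDerivAt_conj {z : ℝ → ℂ} {z' : ℂ} {x : ℝ} (hz : HasDerivAt z z' x) :
    HasDerivAt (fun x => conj (z x)) (conj z') x :=
  (Complex.conjCLE : ℂ →L[ℝ] ℂ).hasFDerivAt.comp_hasDerivAt x hz

theorem deriv_isSpun {a lam d r : ℝ} {δ : ℂ} {s : ℝ → ℝ} {z w : ℝ → ℂ} {q : ℝ → Fin 4 → ℝ}
    {s' x : ℝ} {z' w' : ℂ} {q' : Fin 4 → ℝ} (hs : HasDerivAt s s' x) (hz : HasDerivAt z z' x)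
    (hw : HasDerivAt w w' x) (hq : HasDerivAt q q' x)
    (h : ∀ᶠ x in 𝓝 x, IsSpun a lam d r 1 (s x) δ (z x) (w x) (q x)) :
    let e₁ := phase₁ a lam d (s x)
    let e₂ := phase₂ a lam d (s x)
    let dσ : ℝ := -(lam * (a * d * s'))
    let dρ : ℝ := lam * (a * (s' / d))
    zc q' = r * (z' * e₁ + z x * (Complex.I * dσ * e₁) +
        d * (w' * e₂ + w x * (Complex.I * dρ * e₂))) ∧
      wc q' = r * (δ * (conj w' * e₁ + conj (w x) * (Complex.I * dσ * e₁) +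
        d * (conj z' * e₂ + conj (z x) * (Complex.I * dρ * e₂)))) := by
  intro e₁ e₂ dσ dρ
  have h1 := hasDerivAt_phase₁ a lam d hs
  have h2 := hasDerivAt_phase₂ a lam d hs
  constructor
  · have hA : HasDerivAt (fun x => zc (q x)) (zc q') x := zc.hasFDerivAt.comp_hasDerivAt x hq
    have hB := (((hz.mul h1).add ((hw.mul h2).const_mul (d : ℂ))).const_mul (r : ℂ))
    refine hA.unique (hB.congr_of_eventuallyEq ?_)
    filter_upwards [h] with x hx
    rw [hx.zc_eq]; simp
  · have hA : HasDerivAt (fun x => wc (q x)) (wc q') x := wc.hasFDerivAt.comp_hasDerivAt x hq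
    have hB := (((((hasDerivAt_conj hw).mul h1).add
      (((hasDerivAt_conj hz).mul h2).const_mul (d : ℂ))).const_mul δ).const_mul (r : ℂ))
    refine hA.unique (hB.congr_of_eventuallyEq ?_)
    filter_upwards [h] with x hx
    rw [hx.wc_eq]; simp

/-- The pairing of the conormal direction with the velocity of a spun surface is the contact form. -/
theorem g0_J1_deriv_isSpun {a lam d r : ℝ} (hd : d ≠ 0) {δ : ℂ} (hδ : δ * conj δ = 1) {s : ℝ → ℝ}
    {z w : ℝ → ℂ} {q : ℝ → Fin 4 → ℝ} {s' x : ℝ} {z' w' : ℂ} {q' Q : Fin 4 → ℝ}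
    (hs : HasDerivAt s s' x) (hz : HasDerivAt z z' x)
    (hw : HasDerivAt w w' x) (hq : HasDerivAt q q' x)
    (hzw : ∀ᶠ x in 𝓝 x, z x * conj (z x) - w x * conj (w x) = 1)
    (h : ∀ᶠ x in 𝓝 x, IsSpun a lam d r 1 (s x) δ (z x) (w x) (q x))
    (hQ : IsSpun a lam d r (-1) (s x) δ (z x) (w x) Q) :
    g0 (J1 *ᵥ Q) q' = r ^ 2 * (d ^ 2 - 1) * (conj (z x) * z' - w x * conj w').im ∧
      (conj (z x) * z' - w x * conj w').re = 0 := by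
  have hd0 : conj (z x) * z' + z x * conj z' - w x * conj w' - conj (w x) * w' = 0 := by
    have h1 := (hz.mul (hasDerivAt_conj hz)).sub (hw.mul (hasDerivAt_conj hw))
    have h2 := h1.unique ((hasDerivAt_const x (1 : ℂ)).congr_of_eventuallyEq hzw)
    linear_combination h2
  have key := deriv_isSpun hs hz hw hq h
  have hc := conormal_identity (-(lam * (a * d * s'))) (lam * (a * (s' / d))) d hδ
    (norm_phase₁ a lam d (s x)) (norm_phase₂ a lam d (s x)) hzw.self_of_nhds hd0
  constructor
  · have hz0 : -(lam * (a * d * s')) + d ^ 2 * (lam * (a * (s' / d))) = 0 := by field_simp; ring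
    rw [hz0, sub_zero] at hc
    rw [g0_eq_re, zc_J1, wc_J1, key.1, key.2, hQ.zc_eq, hQ.wc_eq, mul_assoc (r ^ 2) (d ^ 2 - 1), ← hc,
      ← Complex.re_ofReal_mul]
    congr 1
    simp only [map_mul, Complex.conj_ofReal]
    push_cast
    ring
  · have := congrArg Complex.re hd0
    simp only [Complex.sub_re, Complex.add_re, Complex.mul_re, Complex.conj_re, Complex.conj_im,
      Complex.zero_re] at this ⊢
    linarith

/-- The half sum and half difference of `q` and `Q`, suitably scaled, form a Hermitian orthonormal
frame. The phase of its determinant determines `s`, and dividing the columns by the phases of `γ(s)`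
leaves an element of SU(1,1), whence `δ = 1`. -/
theorem exists_spun {E : Type*} [NormedAddCommGroup E] [NormedSpace ℝ E] {U : Set E}
    (hU : IsOpen U) {x₀ : E} (hx₀ : x₀ ∈ U) {a lam d r : ℝ} (ha : 0 < a) (hd : 1 < d)
    (hlam : lam ^ 2 = 1) (hr : 0 < r) {q Q : E → Fin 4 → ℝ} (hq : ContDiffOn ℝ ∞ q U)
    (hQ : ContDiffOn ℝ ∞ Q U) (hqq : ∀ x ∈ U, g0 (q x) (q x) = -r ^ 2 * (d ^ 2 - 1))
    (hQQ : ∀ x ∈ U, g0 (Q x) (Q x) = -r ^ 2 * (d ^ 2 - 1))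
    (hqQ : ∀ x ∈ U, g0 (q x) (Q x) = -r ^ 2 * (d ^ 2 + 1))
    (hJ : ∀ x ∈ U, g0 (J1 *ᵥ q x) (Q x) = 0) :
    ∃ V ⊆ U, IsOpen V ∧ x₀ ∈ V ∧ ∃ (s : E → ℝ) (z w : E → ℂ), ContDiffOn ℝ ∞ s V ∧
      ContDiffOn ℝ ∞ z V ∧ ContDiffOn ℝ ∞ w V ∧
      ∀ x ∈ V, z x * conj (z x) - w x * conj (w x) = 1 ∧
        IsSpun a lam d r 1 (s x) 1 (z x) (w x) (q x) ∧
        IsSpun a lam d r (-1) (s x) 1 (z x) (w x) (Q x) := by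
  have hrc : (r : ℂ) ≠ 0 := by exact_mod_cast hr.ne'
  have hdc : (d : ℂ) ≠ 0 := by exact_mod_cast (by linarith : d ≠ 0)
  set z₁ : E → ℂ := fun x => (zc (q x) - zc (Q x)) / (2 * r) with hz₁
  set w₁ : E → ℂ := fun x => (wc (q x) - wc (Q x)) / (2 * r) with hw₁
  set z₂ : E → ℂ := fun x => (zc (q x) + zc (Q x)) / (2 * d * r) with hz₂
  set w₂ : E → ℂ := fun x => (wc (q x) + wc (Q x)) / (2 * d * r) with hw₂
  set D : E → ℂ := fun x => z₁ x * w₂ x - w₁ x * z₂ x with hD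
  have dz₁ : ContDiffOn ℝ ∞ z₁ U :=
    ((zc.contDiff.comp_contDiffOn hq).sub (zc.contDiff.comp_contDiffOn hQ)).div_const _
  have dw₁ : ContDiffOn ℝ ∞ w₁ U :=
    ((wc.contDiff.comp_contDiffOn hq).sub (wc.contDiff.comp_contDiffOn hQ)).div_const _
  have dz₂ : ContDiffOn ℝ ∞ z₂ U :=
    ((zc.contDiff.comp_contDiffOn hq).add (zc.contDiff.comp_contDiffOn hQ)).div_const _
  have dw₂ : ContDiffOn ℝ ∞ w₂ U :=
    ((wc.contDiff.comp_contDiffOn hq).add (wc.contDiff.comp_contDiffOn hQ)).div_const _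
  have dD : ContDiffOn ℝ ∞ D U := (dz₁.mul dw₂).sub (dw₁.mul dz₂)
  have hfr (x) (hx : x ∈ U) : D x * conj (D x) = 1 ∧ w₁ x = D x * conj (z₂ x) ∧
      w₂ x = D x * conj (z₁ x) ∧ z₁ x * conj (z₁ x) - z₂ x * conj (z₂ x) = 1 := by
    -- The imaginary part of the Hermitian product is measured by `J1`, so `hJ` makes the product of
    -- `q` and `Q` real.
    have herm (p p' : Fin 4 → ℝ) : zc p * conj (zc p') - wc p * conj (wc p') =
        (g0 p p' : ℂ) - Complex.I * (g0 (J1 *ᵥ p) p' : ℂ) := by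
      apply Complex.ext
      · simp [g0]; ring
      · simp [g0, J1_mulVec]; ring
    have h1 := herm (q x) (q x)
    have h2 := herm (Q x) (Q x)
    have h3 := herm (q x) (Q x)
    have h4 := congrArg conj h3
    have hJs (p : Fin 4 → ℝ) : g0 (J1 *ᵥ p) p = 0 := by rw [g0_comm, g0_J1_self]
    rw [hqq x hx, hJs] at h1
    rw [hQQ x hx, hJs] at h2
    rw [hqQ x hx, hJ x hx] at h3 h4
    simp only [map_sub, map_mul, Complex.conj_conj, Complex.conj_ofReal, Complex.conj_I] at h4
    push_cast at h1 h2 h3 h4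
    refine frame_facts ?_ ?_ ?_ rfl
    · simp only [hz₁, hw₁, map_div₀, map_sub, map_mul, Complex.conj_ofReal, map_ofNat]
      field_simp
      linear_combination h1 + h2 - h3 - h4
    · simp only [hz₂, hw₂, map_div₀, map_add, map_mul, Complex.conj_ofReal, map_ofNat]
      field_simp
      linear_combination h1 + h2 + h3 + h4
    · simp only [hz₁, hw₁, hz₂, hw₂, map_div₀, map_add, map_mul, Complex.conj_ofReal,
        map_ofNat]
      field_simp
      linear_combination h1 - h2 + h3 - h4
  have hDn (x) (hx : x ∈ U) : ‖D x‖ = 1 := by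
    have := (hfr x hx).1
    rw [Complex.mul_conj, Complex.normSq_eq_norm_sq] at this
    have h2 : ‖D x‖ ^ 2 = 1 := by exact_mod_cast this
    exact (pow_eq_one_iff_of_nonneg (norm_nonneg _) two_ne_zero).1 h2
  have hD0 : D x₀ ≠ 0 := norm_ne_zero_iff.1 (by rw [hDn x₀ hx₀]; norm_num)
  obtain ⟨V, hVU, hV, hxV, θ, hθ, hDθ⟩ := exists_smooth_arg hU hx₀ dD hD0
  have hm : a * (1 / d - d) ≠ 0 := by
    refine mul_ne_zero ha.ne' ?_
    rw [div_sub' (by linarith), div_ne_zero_iff]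
    exact ⟨by nlinarith, by linarith⟩
  -- Solves `lam * a * (1/d - d) * s = θ`, so that the product of the two phases is the determinant
  -- `D`; the inverse of `lam` is `lam`, and `d > 1` keeps the divisor nonzero.
  set s : E → ℝ := fun x => lam * θ x / (a * (1 / d - d)) with hs
  have ds : ContDiffOn ℝ ∞ s V := (contDiffOn_const.mul hθ).div_const _
  have hphase (x) (hx : x ∈ V) :
      D x = phase₁ a lam d (s x) * phase₂ a lam d (s x) := by
    rw [(hDθ x hx).2, hDn x (hVU hx), phase₁, phase₂, ← Complex.exp_add, ← add_mul,
      ← Complex.ofReal_add]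
    have : -(lam * (a * d * s x)) + lam * (a * (s x / d)) = θ x := by
      have : -(lam * (a * d * s x)) + lam * (a * (s x / d)) = lam * (a * (1 / d - d)) * s x := by
        ring
      rw [this]
      change lam * (a * (1 / d - d)) * (lam * θ x / (a * (1 / d - d))) = θ x
      generalize a * (1 / d - d) = m at hm ⊢
      field_simp
      linear_combination θ x * hlam
    rw [this]; simp
  have dp₁ : ContDiffOn ℝ ∞ (fun x => conj (phase₁ a lam d (s x))) V := by
    refine Complex.conjCLE.contDiff.comp_contDiffOn (ContDiffOn.cexp ?_)
    exact (Complex.ofRealCLM.contDiff.comp_contDiffOn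
      (contDiffOn_const.mul (contDiffOn_const.mul ds)).neg).mul contDiffOn_const
  have dp₂ : ContDiffOn ℝ ∞ (fun x => conj (phase₂ a lam d (s x))) V := by
    refine Complex.conjCLE.contDiff.comp_contDiffOn (ContDiffOn.cexp ?_)
    exact (Complex.ofRealCLM.contDiff.comp_contDiffOn
      (contDiffOn_const.mul (contDiffOn_const.mul (ds.div_const d)))).mul contDiffOn_const
  refine ⟨V, hVU, hV, hxV, s, fun x => z₁ x * conj (phase₁ a lam d (s x)),
    fun x => z₂ x * conj (phase₂ a lam d (s x)), ds, (dz₁.mono hVU).mul dp₁,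
    (dz₂.mono hVU).mul dp₂, fun x hx => ?_⟩
  obtain ⟨-, h1, h2, h3⟩ := hfr x (hVU hx)
  have n1 := norm_phase₁ a lam d (s x)
  have n2 := norm_phase₂ a lam d (s x)
  rw [hphase x hx] at h1 h2
  have eq1 : zc (q x) = r * (z₁ x + d * z₂ x) := by simp only [hz₁, hz₂]; field_simp; ring
  have eq2 : wc (q x) = r * (w₁ x + d * w₂ x) := by simp only [hw₁, hw₂]; field_simp; ring
  have eq3 : zc (Q x) = r * (-z₁ x + d * z₂ x) := by simp only [hz₁, hz₂]; field_simp; ring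
  have eq4 : wc (Q x) = r * (-w₁ x + d * w₂ x) := by simp only [hw₁, hw₂]; field_simp; ring
  rw [h1, h2] at eq2 eq4
  refine ⟨?_, ⟨?_, ?_⟩, ⟨?_, ?_⟩⟩ <;> simp only [map_mul, Complex.conj_conj] <;>
    generalize phase₁ a lam d (s x) = e₁ at * <;> generalize phase₂ a lam d (s x) = e₂ at * <;>
    push_cast
  · linear_combination h3 + z₁ x * conj (z₁ x) * n1 - z₂ x * conj (z₂ x) * n2
  · linear_combination eq1 - r * z₁ x * n1 - r * d * z₂ x * n2
  · linear_combination eq2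
  · linear_combination eq3 + r * z₁ x * n1 - r * d * z₂ x * n2
  · linear_combination eq4

/-! ### Helix surfaces in local coordinates -/

section

/-- Parseval's identity: `q, J1 q, J2 q, J3 q` are mutually orthogonal, with squares `g0 q q` times
`1, 1, -1, -1`. -/
theorem g0_polar (q v w : Fin 4 → ℝ) :
    g0 q q * g0 v w = g0 v q * g0 w q + g0 v (J1 *ᵥ q) * g0 w (J1 *ᵥ q) -
      g0 v (J2 *ᵥ q) * g0 w (J2 *ᵥ q) - g0 v (J3 *ᵥ q) * g0 w (J3 *ᵥ q) := by
  simp [g0, J1_mulVec, J2_mulVec, J3_mulVec]; ring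

theorem eq_zero_of_g0_frame {q v : Fin 4 → ℝ} (hq : g0 q q ≠ 0) (h : g0 v q = 0)
    (h₁ : g0 v (J1 *ᵥ q) = 0) (h₂ : g0 v (J2 *ᵥ q) = 0) (h₃ : g0 v (J3 *ᵥ q) = 0) : v = 0 := by
  have key (w) : g0 v w = 0 := by
    have := g0_polar q v w
    rw [h, h₁, h₂, h₃] at this
    simpa [hq] using this
  ext i
  have := key (Pi.single i 1)
  fin_cases i <;> simpa [g0] using this

/-- The vertical part of `N` contributes `-ν²` to `gτ(N, N) = lam`; the rest is the horizontal part,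
on which the metric is positive definite. -/
theorem IsAngleNormal.horizontal_sq {κ τ lam ν : ℝ} (hκ : 0 < κ) (hτ : 0 < τ) (hlam : lam ^ 2 = 1)
    {q N : Fin 4 → ℝ} (h : IsAngleNormal κ τ lam ν q N) :
    κ / 4 * (g0 N (J2 *ᵥ q) ^ 2 + g0 N (J3 *ᵥ q) ^ 2) = lam + ν ^ 2 := by
  have h1 := g0_polar q N N
  have h2 := h.g0_J1 hκ hτ hlam
  have h3 := h.unit
  rw [gτ, X1, g0_smul_right] at h3
  have h4 : g0 N (J1 *ᵥ q) = lam * ν / (τ * (√κ / 2)) := by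
    rw [eq_div_iff (by have := Real.sqrt_pos.2 hκ; positivity), ← h2]; ring
  have hk := Real.sq_sqrt hκ.le
  have hk0 := Real.sqrt_pos.2 hκ
  rw [show g0 q q = -4 / κ from h.mem, g0_comm N q, h.tangent, h4] at h1
  rw [h4, show √κ / 2 * (lam * ν / (τ * (√κ / 2))) = lam * ν / τ by field_simp] at h3
  have h5 : g0 N (J2 *ᵥ q) ^ 2 + g0 N (J3 *ᵥ q) ^ 2 =
      4 / κ * g0 N N + (lam * ν / (τ * (√κ / 2))) ^ 2 := by linear_combination h1
  have h6 : g0 N N = lam - (1 - τ ^ 2) * (lam * ν / τ) ^ 2 := by linear_combination h3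
  have h7 : (lam * ν / (τ * (√κ / 2))) ^ 2 = 4 / κ * (lam * ν / τ) ^ 2 := by
    nth_rw 2 [← hk]; field_simp; ring
  rw [h5, h6, h7]
  field_simp
  linear_combination ν ^ 2 * τ ^ 2 * hlam

/-- The contact form `g0 dq (J1 q)` of the Hopf fibration, as a bilinear form in point and velocity.
-/
abbrev twistBilin : (Fin 4 → ℝ) →L[ℝ] (Fin 4 → ℝ) →L[ℝ] ℝ :=
  let π (i : Fin 4) : (Fin 4 → ℝ) →L[ℝ] ℝ := ContinuousLinearMap.proj i
  (ContinuousLinearMap.mul ℝ ℝ).bilinearComp (π 0) (π 1) -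
    (ContinuousLinearMap.mul ℝ ℝ).bilinearComp (π 1) (π 0) -
    (ContinuousLinearMap.mul ℝ ℝ).bilinearComp (π 2) (π 3) +
    (ContinuousLinearMap.mul ℝ ℝ).bilinearComp (π 3) (π 2)

theorem twistBilin_apply (p v : Fin 4 → ℝ) : twistBilin p v = g0 v (J1 *ᵥ p) := by
  simp [twistBilin, g0, J1_mulVec]; ring

/-- A helix surface in coordinates, with unit normal `N`. -/
structure IsLocalHelix (κ τ lam ν : ℝ) (U : Set (EuclideanSpace ℝ (Fin 2)))
    (q N : EuclideanSpace ℝ (Fin 2) → Fin 4 → ℝ) : Prop where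
  isOpen : IsOpen U
  smooth : ContDiffOn ℝ ∞ q U
  smooth_normal : ContDiffOn ℝ ∞ N U
  injective : ∀ x ∈ U, Function.Injective (fderiv ℝ q x)
  angleNormal : ∀ x ∈ U, IsAngleNormal κ τ lam ν (q x) (N x)
  orthogonal : ∀ x ∈ U, ∀ v, gτ κ τ (q x) (fderiv ℝ q x v) (N x) = 0

variable {κ τ lam ν : ℝ} {U : Set (EuclideanSpace ℝ (Fin 2))}
  {q N : EuclideanSpace ℝ (Fin 2) → Fin 4 → ℝ}

theorem IsLocalHelix.hasFDerivAt (h : IsLocalHelix κ τ lam ν U q N)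
    {x : EuclideanSpace ℝ (Fin 2)} (hx : x ∈ U) : HasFDerivAt q (fderiv ℝ q x) x :=
  ((h.smooth.contDiffAt (h.isOpen.mem_nhds hx)).differentiableAt (by simp)).hasFDerivAt

theorem IsLocalHelix.g0_fderiv (h : IsLocalHelix κ τ lam ν U q N)
    {x : EuclideanSpace ℝ (Fin 2)} (hx : x ∈ U) (v : EuclideanSpace ℝ (Fin 2)) :
    g0 (fderiv ℝ q x v) (q x) = 0 := by
  have h1 (i : Fin 4) := ((hasFDerivAt_pi'.1 (h.hasFDerivAt hx) i))
  have h2 := (((h1 0).mul (h1 0)).add ((h1 1).mul (h1 1))).sub ((h1 2).mul (h1 2)) |>.sub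
    ((h1 3).mul (h1 3))
  have h3 : (fun x => g0 (q x) (q x)) =ᶠ[𝓝 x] fun _ => -4 / κ := by
    filter_upwards [h.isOpen.mem_nhds hx] with y hy using (h.angleNormal y hy).mem
  have h4 := congrArg (fun L => L v)
    (h2.unique ((hasFDerivAt_const (-4 / κ) x).congr_of_eventuallyEq h3))
  simp at h4
  simp only [g0]
  linarith

/-- If `lam + ν²` were not positive, `N` would be vertical and every tangent vector horizontal. The
horizontal distribution is contact, so it has no integral surface. -/
theorem IsLocalHelix.pos (hκ : 0 < κ) (hτ : 0 < τ) (hlam : lam ^ 2 = 1)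
    (h : IsLocalHelix κ τ lam ν U q N) {x₀ : EuclideanSpace ℝ (Fin 2)} (hx₀ : x₀ ∈ U) :
    0 < lam + ν ^ 2 := by
  by_contra hneg
  have hk0 := Real.sqrt_pos.2 hκ
  have hk := Real.sq_sqrt hκ.le
  have hz : lam + ν ^ 2 = 0 := by
    have := (h.angleNormal x₀ hx₀).horizontal_sq hκ hτ hlam
    have h2 : 0 ≤ lam + ν ^ 2 := by rw [← this]; positivity
    linarith
  have hν : ν ≠ 0 := by
    rintro rfl
    have : lam = 0 := by simpa using hz
    rw [this] at hlam; norm_num at hlam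
  have hl : lam ≠ 0 := by rintro rfl; norm_num at hlam
  have hcontact (x) (hx : x ∈ U) (v) : g0 (fderiv ℝ q x v) (J1 *ᵥ q x) = 0 := by
    have hn := h.angleNormal x hx
    have h1 := hn.horizontal_sq hκ hτ hlam
    rw [hz, mul_eq_zero, or_iff_right (by positivity)] at h1
    have h2 : g0 (N x) (J2 *ᵥ q x) = 0 := by nlinarith
    have h3 : g0 (N x) (J3 *ᵥ q x) = 0 := by nlinarith
    have h4 := g0_polar (q x) (fderiv ℝ q x v) (N x)
    rw [h2, h3, h.g0_fderiv hx, show g0 (q x) (q x) = -4 / κ from hn.mem] at h4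
    have h5 := h.orthogonal x hx v
    have h6 := hn.g0_J1 hκ hτ hlam
    have h7 : g0 (N x) (J1 *ᵥ q x) ≠ 0 := by
      intro h0
      rw [h0, mul_zero, eq_comm, mul_eq_zero] at h6
      tauto
    rw [gτ, X1, g0_smul_right, g0_smul_right] at h5
    have h8 : g0 (fderiv ℝ q x v) (N x) =
        -(κ / 4) * (g0 (fderiv ℝ q x v) (J1 *ᵥ q x) * g0 (N x) (J1 *ᵥ q x)) := by
      field_simp at h4
      linear_combination -(1 / 4) * h4
    rw [h8] at h5
    have h9 : τ ^ 2 * (κ / 4) * g0 (N x) (J1 *ᵥ q x) * g0 (fderiv ℝ q x v) (J1 *ᵥ q x) = 0 := by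
      linear_combination -h5 + (1 - τ ^ 2) / 4 * g0 (N x) (J1 *ᵥ q x) *
        g0 (fderiv ℝ q x v) (J1 *ᵥ q x) * hk
    have : τ ^ 2 * (κ / 4) * g0 (N x) (J1 *ᵥ q x) ≠ 0 := by positivity
    exact (mul_eq_zero.1 h9).resolve_left this
  have hsymm (v v') := bilin_fderiv_symm twistBilin h.isOpen h.smooth
    (fun x hx v => by rw [twistBilin_apply]; exact hcontact x hx v) hx₀ v v'
  have hq0 : g0 (q x₀) (q x₀) ≠ 0 := by
    rw [show g0 (q x₀) (q x₀) = -4 / κ from (h.angleNormal x₀ hx₀).mem]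
    exact div_ne_zero (by norm_num) hκ.ne'
  -- Vanishing of the exterior derivative of the contact form on two tangent vectors, written in the
  -- horizontal frame `J2 q, J3 q`, is proportionality of their components.
  have hdet (v v') : g0 (fderiv ℝ q x₀ v) (J2 *ᵥ q x₀) * g0 (fderiv ℝ q x₀ v') (J3 *ᵥ q x₀) =
      g0 (fderiv ℝ q x₀ v) (J3 *ᵥ q x₀) * g0 (fderiv ℝ q x₀ v') (J2 *ᵥ q x₀) := by
    have h1 := hsymm v v'
    rw [twistBilin_apply, twistBilin_apply, g0_comm (fderiv ℝ q x₀ v), g0_J1_left] at h1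
    have h2 := g0_polar (q x₀) (J1 *ᵥ fderiv ℝ q x₀ v) (fderiv ℝ q x₀ v')
    rw [show g0 (J1 *ᵥ fderiv ℝ q x₀ v) (fderiv ℝ q x₀ v') = 0 by
      rw [g0_comm]; linarith, h.g0_fderiv hx₀, hcontact x₀ hx₀] at h2
    have e2 (p : Fin 4 → ℝ) : g0 (J1 *ᵥ p) (J2 *ᵥ q x₀) = -g0 p (J3 *ᵥ q x₀) := by
      simp [g0, J1_mulVec, J2_mulVec, J3_mulVec]; ring
    have e3 (p : Fin 4 → ℝ) : g0 (J1 *ᵥ p) (J3 *ᵥ q x₀) = g0 p (J2 *ᵥ q x₀) := by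
      simp [g0, J1_mulVec, J2_mulVec, J3_mulVec]; ring
    rw [e2, e3] at h2
    linarith
  have hzero (v) (h2 : g0 (fderiv ℝ q x₀ v) (J2 *ᵥ q x₀) = 0)
      (h3 : g0 (fderiv ℝ q x₀ v) (J3 *ᵥ q x₀) = 0) : v = 0 :=
    (injective_iff_map_eq_zero _).1 (h.injective x₀ hx₀) v
      (eq_zero_of_g0_frame hq0 (h.g0_fderiv hx₀ v) (hcontact x₀ hx₀ v) h2 h3)
  set e₀ : EuclideanSpace ℝ (Fin 2) := !₂[1, 0]
  set e₁ : EuclideanSpace ℝ (Fin 2) := !₂[0, 1]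
  have hd01 := hdet e₀ e₁
  have hcomb (α β : ℝ) (p) : g0 (fderiv ℝ q x₀ (α • e₀ + β • e₁)) p =
      α * g0 (fderiv ℝ q x₀ e₀) p + β * g0 (fderiv ℝ q x₀ e₁) p := by
    rw [map_add, map_smul, map_smul, g0_add_left, g0_smul_left, g0_smul_left]
  have hindep {α β : ℝ} (h0 : α • e₀ + β • e₁ = 0) : α = 0 ∧ β = 0 := by
    have h1 := congrArg (fun v : EuclideanSpace ℝ (Fin 2) => v 0) h0
    have h2 := congrArg (fun v : EuclideanSpace ℝ (Fin 2) => v 1) h0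
    simp [e₀, e₁] at h1 h2
    exact ⟨h1, h2⟩
  -- Each combination cancels one horizontal component by construction and the other by `hd01`, so
  -- it is zero. Independence of `e₀`, `e₁` then kills the components of `e₁` in turn, forcing `e₁ =
  -- 0`.
  have i1 := hindep (hzero (g0 (fderiv ℝ q x₀ e₁) (J2 *ᵥ q x₀) • e₀ +
    (-g0 (fderiv ℝ q x₀ e₀) (J2 *ᵥ q x₀)) • e₁) (by rw [hcomb]; ring)
    (by rw [hcomb]; linear_combination -hd01))
  have i2 := hindep (hzero (g0 (fderiv ℝ q x₀ e₁) (J3 *ᵥ q x₀) • e₀ +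
    (-g0 (fderiv ℝ q x₀ e₀) (J3 *ᵥ q x₀)) • e₁) (by rw [hcomb]; linear_combination hd01)
    (by rw [hcomb]; ring))
  have := hzero e₁ i1.1 i2.1
  have := congrArg (fun v : EuclideanSpace ℝ (Fin 2) => v 1) this
  simp [e₁] at this

theorem hasDerivAt_line {E F : Type*} [NormedAddCommGroup E] [NormedSpace ℝ E]
    [NormedAddCommGroup F] [NormedSpace ℝ F] {f : E → F} {f' : E →L[ℝ] F} {x : E}
    (hf : HasFDerivAt f f' x) (v : E) : HasDerivAt (fun t : ℝ => f (x + t • v)) (f' v) 0 := by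
  have h2 : HasDerivAt (fun t : ℝ => x + t • v) v 0 := by
    simpa using ((hasDerivAt_id (0 : ℝ)).smul_const v).const_add x
  have h3 : HasFDerivAt f f' (x + (0 : ℝ) • v) := by simpa using hf
  exact h3.comp_hasDerivAt 0 h2

theorem eventually_line_mem {E : Type*} [NormedAddCommGroup E] [NormedSpace ℝ E] {V : Set E}
    (hV : IsOpen V) {x : E} (hx : x ∈ V) (v : E) : ∀ᶠ t : ℝ in 𝓝 0, x + t • v ∈ V := by
  have h2 : Continuous (fun t : ℝ => x + t • v) := by fun_prop
  exact h2.continuousAt.eventually (hV.mem_nhds (by simpa using hx))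

/-- The radius of the first circle factor containing `γ`. -/
theorem radius_sq (hκ : 0 < κ) {d : ℝ} (hd : 1 < d) :
    0 < 2 / √κ * (1 / √(d ^ 2 - 1)) ∧
      (2 / √κ * (1 / √(d ^ 2 - 1))) ^ 2 * (d ^ 2 - 1) = 4 / κ := by
  have hd1 : 0 < d ^ 2 - 1 := by nlinarith
  have h1 := Real.sqrt_pos.2 hκ
  have h2 := Real.sqrt_pos.2 hd1
  refine ⟨by positivity, ?_⟩
  rw [mul_pow, div_pow, div_pow, Real.sq_sqrt hκ.le, Real.sq_sqrt hd1.le]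
  field_simp
  norm_num

/-- The conormal puts the surface in the form `A γ(s)`, orthogonality of the normal makes `A` a
contact map, and the immersion condition makes `(s, z, w)` an immersion, as `exists_polar_chart`
requires. -/
theorem IsLocalHelix.exists_param (hκ : 0 < κ) (hτ : 0 < τ) (hlam : lam = 1 ∨ lam = -1)
    (hB : 0 < B τ lam ν) (h : IsLocalHelix κ τ lam ν U q N)
    {x₀ : EuclideanSpace ℝ (Fin 2)} (hx₀ : x₀ ∈ U) :
    ∃ φ : OpenPartialHomeomorph (EuclideanSpace ℝ (Fin 2)) (EuclideanSpace ℝ (Fin 2)),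
      x₀ ∈ φ.source ∧ φ.source ⊆ U ∧ ContDiffOn ℝ ∞ φ φ.source ∧
      ContDiffOn ℝ ∞ φ.symm φ.target ∧ ∃ (I : Set ℝ) (ξ : ℝ) (ξ₁ ξ₂ ξ₃ : ℝ → ℝ),
        IsAdmissible I ξ₁ ξ₂ ξ₃ ∧ ∀ x ∈ φ.source, φ x 1 ∈ I ∧
          q x = param κ lam (slope τ lam ν) ξ ξ₁ ξ₂ ξ₃ (φ x) := by
  have hlam2 : lam ^ 2 = 1 := by rcases hlam with rfl | rfl <;> norm_num
  have hu := h.pos hκ hτ hlam2 hx₀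
  obtain ⟨hν, hd, -⟩ := slope_facts hτ hB hu
  set d := slope τ lam ν with hdef
  obtain ⟨hr, hr2⟩ := radius_sq hκ hd
  set r := 2 / √κ * (1 / √(d ^ 2 - 1)) with hrdef
  have hd1 : 0 < d ^ 2 - 1 := by nlinarith
  have ha : 0 < √κ / 2 := by have := Real.sqrt_pos.2 hκ; positivity
  set Q : EuclideanSpace ℝ (Fin 2) → Fin 4 → ℝ := fun x => conormal κ τ lam ν (q x) (N x) with hQ
  have hQd : ContDiffOn ℝ ∞ Q U := by
    have hJ : ContDiffOn ℝ ∞ (fun x => J1 *ᵥ N x) U :=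
      (LinearMap.toContinuousLinearMap (Matrix.mulVecLin J1)).contDiff.comp_contDiffOn h.smooth_normal
    exact (hJ.sub (h.smooth.const_smul (conormalShift κ τ lam ν))).const_smul _
  have hf (x) (hx : x ∈ U) := conormal_facts hκ hτ hlam2 hB hu (h.angleNormal x hx)
  obtain ⟨V, hVU, hV, hxV, s, z, w, hs, hz, hw, hspun⟩ := exists_spun h.isOpen hx₀ ha hd hlam2 hr
    h.smooth hQd
    (fun x hx => by
      rw [show g0 (q x) (q x) = -4 / κ from (h.angleNormal x hx).mem]
      linear_combination hr2)
    (fun x hx => by rw [(hf x hx).1]; linear_combination hr2)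
    (fun x hx => by
      have := (hf x hx).2.2
      apply mul_left_cancel₀ hd1.ne'
      rw [this]
      linear_combination (d ^ 2 + 1) * hr2)
    (fun x hx => (hf x hx).2.1)
  have dat {F : Type} [NormedAddCommGroup F] [NormedSpace ℝ F]
      {f : EuclideanSpace ℝ (Fin 2) → F} (hf : ContDiffOn ℝ ∞ f V)
      {x} (hx : x ∈ V) (v) : HasDerivAt (fun t : ℝ => f (x + t • v)) (fderiv ℝ f x v) 0 :=
    hasDerivAt_line ((hf.contDiffAt (hV.mem_nhds hx)).differentiableAt (by simp)).hasFDerivAt v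
  obtain ⟨φ, hxφ, hφV, hφ, hφ', I, ξ₁, ξ₂, ξ₃, hadm, hrep⟩ := exists_polar_chart hV hxV hs hz hw
    (fun x hx => (hspun x hx).1)
    (by
      intro x hx v
      have key := g0_J1_deriv_isSpun (a := √κ / 2) (lam := lam) (d := d) (r := r) (δ := 1) (Q := Q x)
        (by linarith) (by simp) (dat hs hx v) (dat hz hx v) (dat hw hx v)
        (hasDerivAt_line (h.hasFDerivAt (hVU hx)) v)
        ((eventually_line_mem hV hx v).mono fun t ht => (hspun _ ht).1)
        ((eventually_line_mem hV hx v).mono fun t ht => (hspun _ ht).2.1)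
        (by simpa using (hspun x hx).2.2)
      have h1 := gτ_eq_conormal (ν := ν) hτ ((h.angleNormal x (hVU hx)).g0_J1 hκ hτ hlam2)
        (fderiv ℝ q x v)
      rw [h.orthogonal x (hVU hx), mul_zero, eq_comm, neg_eq_zero] at h1
      rw [h1] at key
      simp only [zero_smul, add_zero] at key
      refine Complex.ext key.2 ?_
      have hne : r ^ 2 * (d ^ 2 - 1) ≠ 0 := by positivity
      exact (mul_eq_zero.1 key.1.symm).resolve_left hne)
    (by
      intro x hx v h1 h2 h3
      have key := deriv_isSpun (a := √κ / 2) (lam := lam) (d := d) (r := r) (δ := 1)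
        (dat hs hx v) (dat hz hx v) (dat hw hx v)
        (hasDerivAt_line (h.hasFDerivAt (hVU hx)) v)
        ((eventually_line_mem hV hx v).mono fun t ht => (hspun _ ht).2.1)
      simp only [h1, h2, h3] at key
      have h0 : fderiv ℝ q x v = 0 :=
        ext_zc_wc (by rw [key.1]; simp) (by rw [key.2]; simp)
      exact (injective_iff_map_eq_zero _).1 (h.injective x (hVU hx)) v h0)
  -- The frame was normalised to determinant one, and `-i e^{iξ} = 1` for `ξ = π/2`.
  refine ⟨φ, hxφ, hφV.trans hVU, hφ, hφ', I, Real.pi / 2, ξ₁, ξ₂, ξ₃, hadm, fun x hx => ?_⟩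
  obtain ⟨h0, h1, h2, h3⟩ := hrep x hx
  refine ⟨h1, ?_⟩
  have e := (hspun x (hφV hx)).2.1
  have e' := isSpun_param hlam κ d (Real.pi / 2) ξ₁ ξ₂ ξ₃ (φ x)
  rw [← h2, ← h3, h0, show -Complex.I * Complex.exp ((Real.pi / 2 : ℝ) * Complex.I) = 1 by
    push_cast; rw [Complex.exp_pi_div_two_mul_I]; simp] at e'
  exact e.ext e'

end

/-! ### The curve `γ` and its torus -/

section Curve

variable {κ lam d : ℝ}

theorem curve_eq (κ lam d s : ℝ) : curve κ lam d s =
    let r := 2 / √κ * (1 / √(d ^ 2 - 1))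
    ![r * Real.cos (√κ / 2 * d * s), -(lam * r) * Real.sin (√κ / 2 * d * s),
      r * d * Real.cos (√κ / 2 / d * s), lam * r * d * Real.sin (√κ / 2 / d * s)] := by
  have e : √κ / 2 * (s / d) = √κ / 2 / d * s := by ring
  ext i
  fin_cases i <;> simp [curve, e] <;> ring

theorem hasDerivAt_cos_mul (c α s : ℝ) :
    HasDerivAt (fun s => c * Real.cos (α * s)) (-(c * α) * Real.sin (α * s)) s := by
  have := (((hasDerivAt_id s).const_mul α).cos).const_mul c
  refine this.congr_deriv ?_
  simp; ring

theorem hasDerivAt_sin_mul (c α s : ℝ) :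
    HasDerivAt (fun s => c * Real.sin (α * s)) (c * α * Real.cos (α * s)) s := by
  have := (((hasDerivAt_id s).const_mul α).sin).const_mul c
  refine this.congr_deriv ?_
  simp; ring

theorem deriv_curve (κ lam d : ℝ) : deriv (curve κ lam d) = fun s =>
    let r := 2 / √κ * (1 / √(d ^ 2 - 1))
    ![-(r * (√κ / 2 * d)) * Real.sin (√κ / 2 * d * s),
      -(lam * r) * (√κ / 2 * d) * Real.cos (√κ / 2 * d * s),
      -(r * d * (√κ / 2 / d)) * Real.sin (√κ / 2 / d * s),
      lam * r * d * (√κ / 2 / d) * Real.cos (√κ / 2 / d * s)] := by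
  funext s
  refine HasDerivAt.deriv ?_
  rw [funext (curve_eq κ lam d), hasDerivAt_pi]
  intro i
  fin_cases i
  exacts [hasDerivAt_cos_mul _ _ _, hasDerivAt_sin_mul _ _ _, hasDerivAt_cos_mul _ _ _,
    hasDerivAt_sin_mul _ _ _]

theorem deriv_deriv_curve (κ lam d s : ℝ) : deriv (deriv (curve κ lam d)) s =
    ![-(√κ / 2 * d) ^ 2 * curve κ lam d s 0, -(√κ / 2 * d) ^ 2 * curve κ lam d s 1,
      -(√κ / 2 / d) ^ 2 * curve κ lam d s 2, -(√κ / 2 / d) ^ 2 * curve κ lam d s 3] := by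
  refine HasDerivAt.deriv ?_
  rw [deriv_curve, hasDerivAt_pi]
  intro i
  fin_cases i
  · refine (hasDerivAt_sin_mul _ _ _).congr_deriv ?_
    simp [curve_eq]; ring
  · refine (hasDerivAt_cos_mul _ _ _).congr_deriv ?_
    simp [curve_eq]; ring
  · refine (hasDerivAt_sin_mul _ _ _).congr_deriv ?_
    simp [curve_eq]; ring
  · refine (hasDerivAt_cos_mul _ _ _).congr_deriv ?_
    simp [curve_eq]; ring

theorem contDiff_curve (κ lam d : ℝ) : ContDiff ℝ ∞ (curve κ lam d) := by
  rw [funext (curve_eq κ lam d), contDiff_pi]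
  intro i
  fin_cases i <;> simp <;> fun_prop

theorem curve_mem_torus (hlam : lam ^ 2 = 1) (s : ℝ) : curve κ lam d s ∈
    torus (2 / √κ * (1 / √(d ^ 2 - 1))) (2 / √κ * (d / √(d ^ 2 - 1))) := by
  rw [curve_eq, torus]
  set r := 2 / √κ * (1 / √(d ^ 2 - 1)) with hr
  rw [show 2 / √κ * (d / √(d ^ 2 - 1)) = r * d by rw [hr]; ring]
  have h1 := Real.sin_sq_add_cos_sq (√κ / 2 * d * s)
  have h2 := Real.sin_sq_add_cos_sq (√κ / 2 / d * s)
  constructor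
  · simp
    linear_combination r ^ 2 * h1 + r ^ 2 * Real.sin (√κ / 2 * d * s) ^ 2 * hlam
  · simp
    linear_combination r ^ 2 * d ^ 2 * h2 + r ^ 2 * d ^ 2 * Real.sin (√κ / 2 / d * s) ^ 2 * hlam

theorem torus_subset_AdS (hκ : 0 < κ) (hd : 1 < d) :
    torus (2 / √κ * (1 / √(d ^ 2 - 1))) (2 / √κ * (d / √(d ^ 2 - 1))) ⊆ AdS κ := by
  rintro q ⟨h1, h2⟩
  obtain ⟨-, hr⟩ := radius_sq hκ hd
  set r := 2 / √κ * (1 / √(d ^ 2 - 1)) with hrdef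
  rw [show 2 / √κ * (d / √(d ^ 2 - 1)) = r * d by rw [hrdef]; ring] at h2
  change g0 q q = _
  simp only [g0]
  linear_combination h1 - h2 - hr

/-- The unit tangents of the two circles are a frame: the first circle lies in the positive definite
plane of `g0`, the second in the negative definite one. -/
theorem isLorentzTorus {r₁ r₂ : ℝ} (h₁ : 0 < r₁) (h₂ : 0 < r₂) : IsLorentzTorus r₁ r₂ := by
  refine ⟨h₁, h₂, fun q ⟨hq1, hq2⟩ => ⟨![-q 1 / r₁, q 0 / r₁, 0, 0], ![0, 0, -q 3 / r₂, q 2 / r₂],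
    ?_, ?_, ?_, ?_⟩⟩
  · ext v
    rw [Submodule.mem_span_pair]
    constructor
    · rintro ⟨hv1, hv2⟩
      refine ⟨(q 0 * v 1 - q 1 * v 0) / r₁, (q 2 * v 3 - q 3 * v 2) / r₂, ?_⟩
      ext i
      fin_cases i <;> simp <;> field_simp
      · linear_combination v 0 * hq1 - q 0 * hv1
      · linear_combination v 1 * hq1 - q 1 * hv1
      · linear_combination v 2 * hq2 - q 2 * hv2
      · linear_combination v 3 * hq2 - q 3 * hv2
    · rintro ⟨a, b, rfl⟩
      constructor <;> simp <;> ring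
  · simp [g0]; field_simp; linear_combination hq1
  · simp [g0]; field_simp; linear_combination -hq2
  · simp [g0]

theorem isTwistedGeodesic_curve (hκ : 0 < κ) (hlam : lam ^ 2 = 1) (hd : 1 < d) :
    IsTwistedGeodesic (2 / √κ * (1 / √(d ^ 2 - 1))) (2 / √κ * (d / √(d ^ 2 - 1)))
        (curve κ lam d) ∧
      ∀ s, g0 (deriv (curve κ lam d) s) (deriv (curve κ lam d) s) = 1 ∧
        speed₁ (curve κ lam d) s / speed₂ (curve κ lam d) s = d := by
  obtain ⟨hr0, hr⟩ := radius_sq hκ hd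
  have hk0 := Real.sqrt_pos.2 hκ
  have hk := Real.sq_sqrt hκ.le
  have hd0 : 0 < d := by linarith
  have hsp (s) : speed₁ (curve κ lam d) s = 2 / √κ * (1 / √(d ^ 2 - 1)) * (√κ / 2 * d) ∧
      speed₂ (curve κ lam d) s = 2 / √κ * (1 / √(d ^ 2 - 1)) * (√κ / 2) := by
    have h1 := Real.sin_sq_add_cos_sq (√κ / 2 * d * s)
    have h2 := Real.sin_sq_add_cos_sq (√κ / 2 / d * s)
    rw [speed₁, speed₂, deriv_curve]
    simp only [Matrix.cons_val]
    generalize 2 / √κ * (1 / √(d ^ 2 - 1)) = r at *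
    constructor
    · rw [Real.sqrt_eq_iff_mul_self_eq (by positivity) (by positivity)]
      linear_combination (r * (√κ / 2 * d)) ^ 2 * h1 +
        (r * (√κ / 2 * d) * Real.cos (√κ / 2 * d * s)) ^ 2 * hlam
    · rw [Real.sqrt_eq_iff_mul_self_eq (by positivity) (by positivity),
        show √κ / 2 = d * (√κ / 2 / d) by field_simp]
      rw [show d * (√κ / 2 / d) / d = √κ / 2 / d by field_simp]
      linear_combination (r * d * (√κ / 2 / d)) ^ 2 * h2 +
        (r * d * (√κ / 2 / d) * Real.cos (√κ / 2 / d * s)) ^ 2 * hlam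
  refine ⟨⟨⟨contDiff_curve κ lam d, curve_mem_torus hlam, ?_⟩, ?_⟩, ?_⟩
  · rintro s v ⟨h1, h2⟩
    rw [deriv_deriv_curve]
    simp only [g0, Matrix.cons_val]
    -- Both components are uniform circular motions, so the acceleration is radial in each factor.
    linear_combination (-(√κ / 2 * d) ^ 2) * h1 + (√κ / 2 / d) ^ 2 * h2
  · intro s
    rw [(hsp s).1, (hsp s).2]
    constructor <;> positivity
  · intro s
    constructor
    · have e (c : ℝ → Fin 4 → ℝ) (s) : g0 (deriv c s) (deriv c s) =
          speed₁ c s ^ 2 - speed₂ c s ^ 2 := by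
        rw [speed₁, speed₂, Real.sq_sqrt (by positivity), Real.sq_sqrt (by positivity), g0]; ring
      rw [e, (hsp s).1, (hsp s).2]
      have : (4 / κ) * (√κ ^ 2) = 4 := by rw [hk]; field_simp
      -- The square of the velocity is `r² (κ/4) (d² - 1)`, and `r² (d² - 1) = 4/κ`.
      linear_combination √κ ^ 2 / 4 * hr + this / 4
    · rw [(hsp s).1, (hsp s).2]
      generalize 2 / √κ * (1 / √(d ^ 2 - 1)) = r at hr0
      field_simp

end Curve

/-! ### The converse: constructing the normal -/

/-- The vector with a given conormal. -/
def ofConormal (κ τ lam ν : ℝ) (q Q : Fin 4 → ℝ) : Fin 4 → ℝ :=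
  -(J1 *ᵥ ((conormalScale κ τ lam ν)⁻¹ • Q + conormalShift κ τ lam ν • q))

/-- Inverts the passage from `N` to `Q`: the Hermitian products in `conormal_facts` are also
sufficient for the recovered vector to be a unit normal with the prescribed angle. -/
theorem isAngleNormal_ofConormal {κ τ lam ν : ℝ} (hκ : 0 < κ) (hτ : 0 < τ) (hlam : lam ^ 2 = 1)
    (hB : 0 < B τ lam ν) (hu : 0 < lam + ν ^ 2) {q Q : Fin 4 → ℝ} (hq : q ∈ AdS κ)
    (hQQ : g0 Q Q = -4 / κ) (hJ : g0 (J1 *ᵥ q) Q = 0)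
    (hqQ : (slope τ lam ν ^ 2 - 1) * g0 q Q = (slope τ lam ν ^ 2 + 1) * (-4 / κ)) :
    IsAngleNormal κ τ lam ν q (ofConormal κ τ lam ν q Q) ∧
      conormal κ τ lam ν q (ofConormal κ τ lam ν q Q) = Q := by
  rw [ofConormal]
  obtain ⟨hν, hd, hs⟩ := slope_facts hτ hB hu
  have hk := Real.sq_sqrt hκ.le
  have hk0 : 0 < √κ := Real.sqrt_pos.2 hκ
  have hb0 : 0 < √(B τ lam ν) := Real.sqrt_pos.2 hB
  have hb : √(B τ lam ν) ^ 2 = ν ^ 2 * (τ ^ 2 - 1) - lam := Real.sq_sqrt hB.le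
  have hv0 : 0 < |ν| := abs_pos.2 hν
  have hv : |ν| ^ 2 = ν ^ 2 := sq_abs ν
  have hl : lam ≠ 0 := by rintro rfl; norm_num at hlam
  have hd1 : slope τ lam ν ^ 2 - 1 ≠ 0 := by nlinarith
  have hμ := conormalScale_ne_zero hκ hlam hν hB
  have eqq : g0 q q = -4 / √κ ^ 2 := by rw [hk]; exact hq
  have eQQ : g0 Q Q = -4 / √κ ^ 2 := by rw [hk]; exact hQQ
  have eqQ : g0 q Q = τ * |ν| / √(B τ lam ν) * (-4 / √κ ^ 2) := by
    apply mul_left_cancel₀ hd1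
    rw [hqQ, ← hk]
    have : slope τ lam ν ^ 2 + 1 = τ * |ν| * (slope τ lam ν ^ 2 - 1) / √(B τ lam ν) := by
      rw [eq_div_iff hb0.ne', hs]
    rw [this, Real.sqrt_sq hk0.le]
    field_simp
  have hinv : (conormalScale κ τ lam ν)⁻¹ = |ν| * (√κ / 2) * √(B τ lam ν) / (lam * ν) := by
    rw [conormalScale, inv_div]
  set X := (conormalScale κ τ lam ν)⁻¹ • Q + conormalShift κ τ lam ν • q with hX
  refine ⟨?_, ?_⟩
  · have neg_left (p p' : Fin 4 → ℝ) : g0 (-p) p' = -g0 p p' := by simp [g0]; ring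
    have neg_right (p p' : Fin 4 → ℝ) : g0 p (-p') = -g0 p p' := by simp [g0]; ring
    have eJ : τ * (√κ / 2) * g0 (-(J1 *ᵥ X)) (J1 *ᵥ q) = lam * ν := by
      rw [neg_left, g0_J1_J1, hX, g0_add_left, g0_smul_left, g0_smul_left, g0_comm Q q, eqq, eqQ,
        hinv, conormalShift]
      field_simp
      linear_combination 4 * τ ^ 2 * hv - 4 * τ ^ 2 * ν ^ 2 * hlam
    have eN : g0 (-(J1 *ᵥ X)) (-(J1 *ᵥ X)) = lam - (1 - τ ^ 2) * (lam * ν / τ) ^ 2 := by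
      rw [neg_left, neg_right, g0_J1_J1, hX]
      simp only [g0_add_left, g0_smul_left, g0_add_right, g0_smul_right]
      rw [g0_comm Q q, eqq, eqQ, eQQ, hinv, conormalShift]
      field_simp
      have h3 : lam ^ 3 = lam := by linear_combination lam * hlam
      rw [hb, hv, h3, hlam]
      linear_combination 4 * ν ^ 4 * (1 - τ ^ 2) * hlam
    refine ⟨hq, ?_, ?_, ?_⟩
    · have : g0 (J1 *ᵥ q) q = 0 := by rw [g0_comm, g0_J1_self]
      rw [neg_right, ← g0_J1_left, hX, g0_add_right, g0_smul_right, g0_smul_right, hJ, this]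
      ring
    · have : √κ / 2 * g0 (-(J1 *ᵥ X)) (J1 *ᵥ q) = lam * ν / τ := by
        rw [eq_div_iff hτ.ne', ← eJ]; ring
      rw [gτ, X1, g0_smul_right, this, eN]
      ring
    · rw [gτ_E1 hκ hτ hq, eJ]
      linear_combination ν * hlam
  · rw [conormal, Matrix.mulVec_neg, J1_J1_mulVec, neg_neg, hX, add_sub_cancel_right, smul_smul,
      mul_inv_cancel₀ hμ, one_smul]

theorem contDiffAt_of_zc_wc {E : Type*} [NormedAddCommGroup E] [NormedSpace ℝ E]
    {q : E → Fin 4 → ℝ} {x : E} (hz : ContDiffAt ℝ ∞ (fun x => zc (q x)) x)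
    (hw : ContDiffAt ℝ ∞ (fun x => wc (q x)) x) : ContDiffAt ℝ ∞ q x := by
  rw [contDiffAt_pi]
  intro i
  fin_cases i
  · simpa [Function.comp_def] using Complex.reCLM.contDiff.contDiffAt.comp x hz
  · simpa [Function.comp_def] using Complex.imCLM.contDiff.contDiffAt.comp x hz
  · simpa [Function.comp_def] using Complex.reCLM.contDiff.contDiffAt.comp x hw
  · simpa [Function.comp_def] using Complex.imCLM.contDiff.contDiffAt.comp x hw

theorem contDiffAt_of_isSpun {E : Type*} [NormedAddCommGroup E] [NormedSpace ℝ E]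
    {a lam d r t : ℝ} {δ : ℂ} {s : E → ℝ} {z w : E → ℂ} {q : E → Fin 4 → ℝ} {x : E}
    (hs : ContDiffAt ℝ ∞ s x) (hz : ContDiffAt ℝ ∞ z x) (hw : ContDiffAt ℝ ∞ w x)
    (h : ∀ x, IsSpun a lam d r t (s x) δ (z x) (w x) (q x)) : ContDiffAt ℝ ∞ q x := by
  have h1 : ContDiffAt ℝ ∞ (fun x => phase₁ a lam d (s x)) x :=
    ((Complex.ofRealCLM.contDiff.contDiffAt.comp x
      (contDiffAt_const.mul (contDiffAt_const.mul hs)).neg).mul contDiffAt_const).cexp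
  have h2 : ContDiffAt ℝ ∞ (fun x => phase₂ a lam d (s x)) x :=
    ((Complex.ofRealCLM.contDiff.contDiffAt.comp x
      (contDiffAt_const.mul (contDiffAt_const.mul (hs.div_const d)))).mul contDiffAt_const).cexp
  have hz' : ContDiffAt ℝ ∞ (fun x => conj (z x)) x :=
    Complex.conjCLE.contDiff.contDiffAt.comp x hz
  have hw' : ContDiffAt ℝ ∞ (fun x => conj (w x)) x :=
    Complex.conjCLE.contDiff.contDiffAt.comp x hw
  apply contDiffAt_of_zc_wc
  · rw [funext fun x => (h x).zc_eq]
    exact contDiffAt_const.mul ((contDiffAt_const.mul (hz.mul h1)).add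
      (contDiffAt_const.mul (hw.mul h2)))
  · rw [funext fun x => (h x).wc_eq]
    exact contDiffAt_const.mul (contDiffAt_const.mul ((contDiffAt_const.mul (hw'.mul h1)).add
      (contDiffAt_const.mul (hz'.mul h2))))

/-- Reflection of the first complex coordinate. -/
def flip₁ (q : Fin 4 → ℝ) : Fin 4 → ℝ := ![-q 0, -q 1, q 2, q 3]

theorem zc_flip₁ (q : Fin 4 → ℝ) : zc (flip₁ q) = -zc q := by
  apply Complex.ext <;> simp [flip₁]

theorem wc_flip₁ (q : Fin 4 → ℝ) : wc (flip₁ q) = wc q := by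
  apply Complex.ext <;> simp [flip₁]

/-- The conormal direction of the surface `F(s,y) = A(y) γ(s)`. -/
def paramConormal (κ lam d ξ : ℝ) (ξ₁ ξ₂ ξ₃ : ℝ → ℝ) (p : EuclideanSpace ℝ (Fin 2)) : Fin 4 → ℝ :=
  matA ξ (ξ₁ (p 1)) (ξ₂ (p 1)) (ξ₃ (p 1)) *ᵥ flip₁ (curve κ lam d (p 0))

theorem isSpun_paramConormal {lam : ℝ} (hlam : lam = 1 ∨ lam = -1) (κ d ξ : ℝ) (ξ₁ ξ₂ ξ₃ : ℝ → ℝ)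
    (p : EuclideanSpace ℝ (Fin 2)) :
    IsSpun (√κ / 2) lam d (2 / √κ * (1 / √(d ^ 2 - 1))) (-1) (p 0)
      (-Complex.I * Complex.exp (ξ * Complex.I))
      (Real.cosh (ξ₁ (p 1)) * Complex.exp (ξ₂ (p 1) * Complex.I))
      (Real.sinh (ξ₁ (p 1)) * Complex.exp (ξ₃ (p 1) * Complex.I))
      (paramConormal κ lam d ξ ξ₁ ξ₂ ξ₃ p) := by
  constructor
  · rw [paramConormal, zc_matA, zc_flip₁, wc_flip₁, zc_curve hlam, wc_curve hlam]
    push_cast; ring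
  · rw [paramConormal, wc_matA, zc_flip₁, wc_flip₁, zc_curve hlam, wc_curve hlam]
    push_cast; ring

section Converse

variable {κ τ lam ν : ℝ} {I : Set ℝ} {ξ : ℝ} {ξ₁ ξ₂ ξ₃ : ℝ → ℝ}

theorem contDiffAt_param (hlam : lam = 1 ∨ lam = -1) (hadm : IsAdmissible I ξ₁ ξ₂ ξ₃) (d : ℝ)
    {p : EuclideanSpace ℝ (Fin 2)} (hp : p 1 ∈ I) :
    ContDiffAt ℝ ∞ (param κ lam d ξ ξ₁ ξ₂ ξ₃) p ∧
      ContDiffAt ℝ ∞ (paramConormal κ lam d ξ ξ₁ ξ₂ ξ₃) p := by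
  have hs (i : Fin 2) : ContDiffAt ℝ ∞ (fun p : EuclideanSpace ℝ (Fin 2) => p i) p :=
    (EuclideanSpace.proj (𝕜 := ℝ) i).contDiff.contDiffAt
  have hcomp {f : ℝ → ℝ} (hf : ContDiffOn ℝ ∞ f I) :
      ContDiffAt ℝ ∞ (fun p : EuclideanSpace ℝ (Fin 2) => f (p 1)) p :=
    ContDiffAt.comp (g := f) p (hf.contDiffAt (hadm.isOpen.mem_nhds hp)) (hs 1)
  have hexp {f : ℝ → ℝ} (hf : ContDiffOn ℝ ∞ f I) : ContDiffAt ℝ ∞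
      (fun p : EuclideanSpace ℝ (Fin 2) => Complex.exp (f (p 1) * Complex.I)) p :=
    ((Complex.ofRealCLM.contDiff.contDiffAt.comp p (hcomp hf)).mul contDiffAt_const).cexp
  have hz : ContDiffAt ℝ ∞ (fun p : EuclideanSpace ℝ (Fin 2) =>
      (Real.cosh (ξ₁ (p 1)) : ℂ) * Complex.exp (ξ₂ (p 1) * Complex.I)) p :=
    (Complex.ofRealCLM.contDiff.contDiffAt.comp p (hcomp hadm.smooth₁).cosh).mul (hexp hadm.smooth₂)
  have hw : ContDiffAt ℝ ∞ (fun p : EuclideanSpace ℝ (Fin 2) =>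
      (Real.sinh (ξ₁ (p 1)) : ℂ) * Complex.exp (ξ₃ (p 1) * Complex.I)) p :=
    (Complex.ofRealCLM.contDiff.contDiffAt.comp p (hcomp hadm.smooth₁).sinh).mul (hexp hadm.smooth₃)
  exact ⟨contDiffAt_of_isSpun (hs 0) hz hw (isSpun_param hlam κ d ξ ξ₁ ξ₂ ξ₃),
    contDiffAt_of_isSpun (hs 0) hz hw (isSpun_paramConormal hlam κ d ξ ξ₁ ξ₂ ξ₃)⟩

/-- In polar coordinates the contact form of `A` is `cosh²ξ₁ dξ₂ + sinh²ξ₁ dξ₃` up to the factor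
`i`, so the equation on the `ξᵢ` is exactly orthogonality. -/
theorem g0_paramConormal_fderiv (hlam : lam = 1 ∨ lam = -1) (hadm : IsAdmissible I ξ₁ ξ₂ ξ₃)
    {d : ℝ} (hd : d ≠ 0) {p : EuclideanSpace ℝ (Fin 2)} (hp : p 1 ∈ I)
    (v : EuclideanSpace ℝ (Fin 2)) :
    g0 (J1 *ᵥ paramConormal κ lam d ξ ξ₁ ξ₂ ξ₃ p)
      (fderiv ℝ (param κ lam d ξ ξ₁ ξ₂ ξ₃) p v) = 0 := by
  have hline (i : Fin 2) : HasDerivAt (fun t : ℝ => (p + t • v) i) (v i) 0 :=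
    hasDerivAt_line (EuclideanSpace.proj (𝕜 := ℝ) i).hasFDerivAt v
  have hcomp {f : ℝ → ℝ} (hf : ContDiffOn ℝ ∞ f I) :
      HasDerivAt (fun t : ℝ => f ((p + t • v) 1)) (deriv f (p 1) * v 1) 0 := by
    have h1 : HasDerivAt f (deriv f (p 1)) ((p + (0 : ℝ) • v) 1) := by
      simpa using ((hf.contDiffAt (hadm.isOpen.mem_nhds hp)).differentiableAt (by simp)).hasDerivAt
    exact h1.comp (0 : ℝ) (hline 1)
  have h1 := hcomp hadm.smooth₁
  have hz := hasDerivAt_polar_cosh h1 (hcomp hadm.smooth₂)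
  have hw := hasDerivAt_polar_sinh h1 (hcomp hadm.smooth₃)
  have hF := hasDerivAt_line
    ((contDiffAt_param (κ := κ) (ξ := ξ) hlam hadm d hp).1.differentiableAt (by simp)).hasFDerivAt v
  have key := (g0_J1_deriv_isSpun hd (norm_delta ξ) (hline 0) hz hw hF
    (Eventually.of_forall fun t => by
      have h2 := norm_expI (ξ₂ ((p + t • v) 1))
      have h3 := norm_expI (ξ₃ ((p + t • v) 1))
      have hc : (Real.cosh (ξ₁ ((p + t • v) 1)) : ℂ) ^ 2 -
          (Real.sinh (ξ₁ ((p + t • v) 1)) : ℂ) ^ 2 = 1 := by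
        exact_mod_cast Real.cosh_sq_sub_sinh_sq _
      simp only [map_mul, Complex.conj_ofReal]
      linear_combination hc + (Real.cosh (ξ₁ ((p + t • v) 1)) : ℂ) ^ 2 * h2 -
        (Real.sinh (ξ₁ ((p + t • v) 1)) : ℂ) ^ 2 * h3)
    (Eventually.of_forall fun t => isSpun_param hlam κ d ξ ξ₁ ξ₂ ξ₃ (p + t • v))
    (isSpun_paramConormal hlam κ d ξ ξ₁ ξ₂ ξ₃ (p + (0 : ℝ) • v))).1
  rw [polar_contact _ _ _ _ _ _ _ _ (by ring)] at key
  simp only [zero_smul, add_zero] at key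
  rw [key]
  have := hadm.ode (p 1) hp
  simp only [Complex.mul_im, Complex.I_re, Complex.I_im, Complex.ofReal_re, Complex.ofReal_im]
  linear_combination (2 / √κ * (1 / √(d ^ 2 - 1))) ^ 2 * (d ^ 2 - 1) * v 1 * this

/-- Since `A` preserves `g0` and commutes with `J1`, all products can be computed on `γ` and its
reflection, where the radii of the torus determine them. -/
theorem isAngleNormal_param (hκ : 0 < κ) (hτ : 0 < τ) (hlam : lam = 1 ∨ lam = -1)
    (hB : 0 < B τ lam ν) (hu : 0 < lam + ν ^ 2) (ξ : ℝ) (ξ₁ ξ₂ ξ₃ : ℝ → ℝ)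
    (p : EuclideanSpace ℝ (Fin 2)) :
    let F := param κ lam (slope τ lam ν) ξ ξ₁ ξ₂ ξ₃ p
    let Q := paramConormal κ lam (slope τ lam ν) ξ ξ₁ ξ₂ ξ₃ p
    IsAngleNormal κ τ lam ν F (ofConormal κ τ lam ν F Q) ∧
      conormal κ τ lam ν F (ofConormal κ τ lam ν F Q) = Q := by
  have hlam2 : lam ^ 2 = 1 := by rcases hlam with rfl | rfl <;> norm_num
  obtain ⟨-, hd, -⟩ := slope_facts hτ hB hu
  intro F Q
  set d := slope τ lam ν
  obtain ⟨h1, h2⟩ := curve_mem_torus (κ := κ) (d := d) hlam2 (p 0)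
  have h3 : g0 (curve κ lam d (p 0)) (curve κ lam d (p 0)) = -4 / κ :=
    torus_subset_AdS hκ hd ⟨h1, h2⟩
  obtain ⟨-, hr⟩ := radius_sq hκ hd
  set r := 2 / √κ * (1 / √(d ^ 2 - 1)) with hrdef
  rw [show 2 / √κ * (d / √(d ^ 2 - 1)) = r * d by rw [hrdef]; ring] at h2
  refine isAngleNormal_ofConormal hκ hτ hlam2 hB hu ?_ ?_ ?_ ?_
  · exact (g0_matA _ _ _ _ _ _).trans h3
  · refine (g0_matA _ _ _ _ _ _).trans (Eq.trans ?_ h3)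
    simp only [g0, flip₁, Matrix.cons_val]
    ring
  · have : J1 *ᵥ F = matA ξ (ξ₁ (p 1)) (ξ₂ (p 1)) (ξ₃ (p 1)) *ᵥ (J1 *ᵥ curve κ lam d (p 0)) := by
      rw [Matrix.mulVec_mulVec, matA_commute_J1, ← Matrix.mulVec_mulVec]; rfl
    rw [this]
    refine (g0_matA _ _ _ _ _ _).trans ?_
    simp [g0, J1_mulVec, flip₁]; ring
  · have : g0 F Q = g0 (curve κ lam d (p 0)) (flip₁ (curve κ lam d (p 0))) := g0_matA _ _ _ _ _ _
    rw [this]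
    simp only [g0, flip₁, Matrix.cons_val]
    linear_combination (1 - d ^ 2) * h1 + (1 - d ^ 2) * h2 - (d ^ 2 + 1) * hr

theorem hasMFDerivAt_comp_subtype_val {F : Type*} [NormedAddCommGroup F] [NormedSpace ℝ F]
    {Ω : TopologicalSpace.Opens (EuclideanSpace ℝ (Fin 2))} {f : EuclideanSpace ℝ (Fin 2) → F}
    {f' : EuclideanSpace ℝ (Fin 2) →L[ℝ] F} {p : Ω} (hf : HasFDerivAt f f' p) :
    HasMFDerivAt (𝓡 2) 𝓘(ℝ, F) (fun p : Ω => f p) p f' := by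
  refine ⟨hf.continuousAt.comp continuousAt_subtype_val, ?_⟩
  have h1 := Ω.chartAt_subtype_val_symm_eventuallyEq (H := EuclideanSpace ℝ (Fin 2)) (x := p)
  have hpt : extChartAt (𝓡 2) p p = (p : EuclideanSpace ℝ (Fin 2)) := rfl
  rw [hpt]
  refine (hf.congr_of_eventuallyEq ?_).hasFDerivWithinAt
  filter_upwards [h1] with x hx
  exact congrArg f hx.symm

theorem isHelixSurface_param (hκ : 0 < κ) (hτ : 0 < τ) (hlam : lam = 1 ∨ lam = -1)
    (hB : 0 < B τ lam ν) (hu : 0 < lam + ν ^ 2) (hadm : IsAdmissible I ξ₁ ξ₂ ξ₃)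
    (Ω : TopologicalSpace.Opens (EuclideanSpace ℝ (Fin 2))) (hΩ : ∀ p ∈ Ω, p 1 ∈ I)
    (himm : ∀ p ∈ Ω, Function.Injective
      (fderiv ℝ (param κ lam (slope τ lam ν) ξ ξ₁ ξ₂ ξ₃) p)) :
    IsHelixSurface κ τ lam ν (fun p : Ω => param κ lam (slope τ lam ν) ξ ξ₁ ξ₂ ξ₃ p) := by
  have hlam2 : lam ^ 2 = 1 := by rcases hlam with rfl | rfl <;> norm_num
  obtain ⟨hν, hd, -⟩ := slope_facts hτ hB hu
  set d := slope τ lam ν with hdef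
  set F := param κ lam d ξ ξ₁ ξ₂ ξ₃ with hF
  set Q := paramConormal κ lam d ξ ξ₁ ξ₂ ξ₃ with hQ
  have hn := isAngleNormal_param hκ hτ hlam hB hu ξ ξ₁ ξ₂ ξ₃
  have hsm (p : Ω) := contDiffAt_param (κ := κ) (ξ := ξ) hlam hadm d (hΩ p p.2)
  have hder (p : Ω) : mfderiv (𝓡 2) 𝓘(ℝ, Fin 4 → ℝ) (fun p : Ω => F p) p =
      fderiv ℝ F (p : EuclideanSpace ℝ (Fin 2)) :=
    (hasMFDerivAt_comp_subtype_val ((hsm p).1.differentiableAt (by simp)).hasFDerivAt).mfderiv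
  have hlift {f : EuclideanSpace ℝ (Fin 2) → Fin 4 → ℝ}
      (hf : ∀ p : Ω, ContDiffAt ℝ ∞ f (p : EuclideanSpace ℝ (Fin 2))) :
      ContMDiff (𝓡 2) 𝓘(ℝ, Fin 4 → ℝ) ∞ (fun p : Ω => f p) := fun p =>
    (hf p).contMDiffAt.comp p contMDiff_subtype_val.contMDiffAt
  refine ⟨hlift fun p => (hsm p).1, fun p => (hn p).1.mem, fun p => ?_,
    fun p => ofConormal κ τ lam ν (F p) (Q p), hlift (f := fun p => ofConormal κ τ lam ν (F p) (Q p))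
      fun p => ?_, fun p => ⟨(hn p).1.tangent, fun v => ?_, (hn p).1.unit, (hn p).1.angle⟩⟩
  · rw [hder]
    exact himm p p.2
  · exact ((LinearMap.toContinuousLinearMap (Matrix.mulVecLin J1)).contDiff.contDiffAt.comp _
      (((hsm p).2.const_smul (conormalScale κ τ lam ν)⁻¹).add
        ((hsm p).1.const_smul (conormalShift κ τ lam ν)))).neg
  · rw [hder]
    have h1 := gτ_eq_conormal (ν := ν) hτ ((hn p).1.g0_J1 hκ hτ hlam2) (fderiv ℝ F p v)
    rw [(hn p).2] at h1
    rw [show g0 (J1 *ᵥ _) (fderiv ℝ F p v) = 0 from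
      g0_paramConormal_fderiv hlam hadm (by linarith) (hΩ p p.2) v, neg_zero, mul_eq_zero] at h1
    exact h1.resolve_left (conormalScale_ne_zero hκ hlam2 hν hB)

end Converse

/-! ### From charts to the manifold, and the theorem -/

theorem IsHelixSurface.exists_isLocalHelix {κ τ lam ν : ℝ} {M : Type*} [TopologicalSpace M]
    [ChartedSpace (EuclideanSpace ℝ (Fin 2)) M] [IsManifold (𝓡 2) ∞ M] {f : M → Fin 4 → ℝ}
    (h : IsHelixSurface κ τ lam ν f) (p : M) :
    ∃ N, IsLocalHelix κ τ lam ν (chartAt (EuclideanSpace ℝ (Fin 2)) p).target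
      (f ∘ (chartAt (EuclideanSpace ℝ (Fin 2)) p).symm) N := by
  obtain ⟨N, hN, hN'⟩ := h.exists_normal
  set χ := chartAt (EuclideanSpace ℝ (Fin 2)) p
  have hχ : χ ∈ IsManifold.maximalAtlas (𝓡 2) ∞ M := IsManifold.chart_mem_maximalAtlas p
  have hsymm := contMDiffOn_symm_of_mem_maximalAtlas hχ
  have hder (x : EuclideanSpace ℝ (Fin 2)) (hx : x ∈ χ.target) : fderiv ℝ (f ∘ χ.symm) x =
      (mfderiv (𝓡 2) 𝓘(ℝ, Fin 4 → ℝ) f (χ.symm x)).comp (mfderiv (𝓡 2) (𝓡 2) χ.symm x) := by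
    rw [← mfderiv_eq_fderiv]
    exact mfderiv_comp x (h.smooth.mdifferentiable (by simp) _)
      ((mdifferentiable_chart p).mdifferentiableAt_symm hx)
  have hcomp {g : M → Fin 4 → ℝ} (hg : ContMDiff (𝓡 2) 𝓘(ℝ, Fin 4 → ℝ) ∞ g) :
      ContDiffOn ℝ ∞ (g ∘ χ.symm) χ.target :=
    (hg.comp_contMDiffOn hsymm).contDiffOn
  refine ⟨N ∘ χ.symm, χ.open_target, hcomp h.smooth, hcomp hN, fun x hx => ?_, fun x _ => ?_,
    fun x hx v => ?_⟩
  · rw [hder x hx]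
    exact (h.immersion _).comp ((mdifferentiable_chart p).symm.mfderiv_injective hx)
  · obtain ⟨h1, -, h2, h3⟩ := hN' (χ.symm x)
    exact ⟨h.mem_AdS _, h1, h2, h3⟩
  · rw [hder x hx]
    exact (hN' (χ.symm x)).2.1 _

theorem IsHelixSurface.exists_chart {κ τ lam ν : ℝ} (hκ : 0 < κ) (hτ : 0 < τ)
    (hlam : lam = 1 ∨ lam = -1) (hB : 0 < B τ lam ν) {M : Type*} [TopologicalSpace M]
    [ChartedSpace (EuclideanSpace ℝ (Fin 2)) M] [IsManifold (𝓡 2) ∞ M] {f : M → Fin 4 → ℝ}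
    (h : IsHelixSurface κ τ lam ν f) (p : M) :
    ∃ e ∈ IsManifold.maximalAtlas (𝓡 2) ∞ M, p ∈ e.source ∧
      ∃ (I : Set ℝ) (ξ : ℝ) (ξ₁ ξ₂ ξ₃ : ℝ → ℝ), IsAdmissible I ξ₁ ξ₂ ξ₃ ∧
        ∀ q ∈ e.source, e q 1 ∈ I ∧ f q = param κ lam (slope τ lam ν) ξ ξ₁ ξ₂ ξ₃ (e q) := by
  obtain ⟨N, hN⟩ := h.exists_isLocalHelix p
  set χ := chartAt (EuclideanSpace ℝ (Fin 2)) p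
  have hp : p ∈ χ.source := mem_chart_source _ p
  have hχ : χ ∈ IsManifold.maximalAtlas (𝓡 2) ∞ M := IsManifold.chart_mem_maximalAtlas p
  obtain ⟨φ, hpφ, -, hφ, hφ', I, ξ, ξ₁, ξ₂, ξ₃, hadm, hparam⟩ :=
    hN.exists_param hκ hτ hlam hB (χ.map_source hp)
  refine ⟨χ.trans φ, ?_, ?_, I, ξ, ξ₁, ξ₂, ξ₃, hadm, fun q hq => ?_⟩
  · apply OpenPartialHomeomorph.mem_maximalAtlas_of_contMDiffOn
    · rw [OpenPartialHomeomorph.trans_source]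
      exact hφ.contMDiffOn.comp ((contMDiffOn_of_mem_maximalAtlas hχ).mono Set.inter_subset_left)
        fun x hx => hx.2
    · rw [OpenPartialHomeomorph.trans_target]
      exact (contMDiffOn_symm_of_mem_maximalAtlas hχ).comp
        (hφ'.contMDiffOn.mono Set.inter_subset_left) fun x hx => hx.2
  · rw [OpenPartialHomeomorph.trans_source]
    exact ⟨hp, hpφ⟩
  · rw [OpenPartialHomeomorph.trans_source] at hq
    obtain ⟨h1, h2⟩ := hparam (χ q) hq.2
    rw [Function.comp_apply, χ.left_inv hq.1] at h2
    exact ⟨h1, h2⟩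

end AntiDeSitter

end

theorem corollary6p3 (κ τ lam ν : ℝ) (hκ : 0 < κ) (hτ : 0 < τ) (hlam : lam = 1 ∨ lam = -1)
    (hB : 0 < AntiDeSitter.B τ lam ν) :
    -- every helix surface is locally of the form `A(y) γ(s)`
    (∀ (M : Type*) [TopologicalSpace M] [ChartedSpace (EuclideanSpace ℝ (Fin 2)) M]
      [IsManifold (𝓡 2) ∞ M] (f : M → Fin 4 → ℝ),
      AntiDeSitter.IsHelixSurface κ τ lam ν f →
      ∀ p : M, 0 < lam + ν ^ 2 ∧
        ∃ e ∈ IsManifold.maximalAtlas (𝓡 2) ∞ M, p ∈ e.source ∧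
        ∃ (I : Set ℝ) (ξ : ℝ) (ξ₁ ξ₂ ξ₃ : ℝ → ℝ),
          AntiDeSitter.IsAdmissible I ξ₁ ξ₂ ξ₃ ∧
          (∀ y ∈ I, AntiDeSitter.IsPseudoOrthogonal
              (AntiDeSitter.matA ξ (ξ₁ y) (ξ₂ y) (ξ₃ y)) ∧
            AntiDeSitter.matA ξ (ξ₁ y) (ξ₂ y) (ξ₃ y) * AntiDeSitter.J1 =
              AntiDeSitter.J1 * AntiDeSitter.matA ξ (ξ₁ y) (ξ₂ y) (ξ₃ y)) ∧
          ∀ q ∈ e.source, e q 1 ∈ I ∧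
            f q = AntiDeSitter.param κ lam (AntiDeSitter.slope τ lam ν) ξ ξ₁ ξ₂ ξ₃ (e q)) ∧
    (0 < lam + ν ^ 2 →
      -- `γ` is an arc-length twisted geodesic of slope `d` of the Lorentz torus
      (∀ d r₁ r₂ : ℝ, d = AntiDeSitter.slope τ lam ν →
        r₁ = 2 / √κ * (1 / √(d ^ 2 - 1)) → r₂ = 2 / √κ * (d / √(d ^ 2 - 1)) →
        1 < d ∧
        AntiDeSitter.IsLorentzTorus r₁ r₂ ∧
        AntiDeSitter.torus r₁ r₂ ⊆ AntiDeSitter.AdS κ ∧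
        AntiDeSitter.IsTwistedGeodesic r₁ r₂ (AntiDeSitter.curve κ lam d) ∧
        ∀ s, AntiDeSitter.g0 (deriv (AntiDeSitter.curve κ lam d) s)
              (deriv (AntiDeSitter.curve κ lam d) s) = 1 ∧
          AntiDeSitter.speed₁ (AntiDeSitter.curve κ lam d) s /
            AntiDeSitter.speed₂ (AntiDeSitter.curve κ lam d) s = d) ∧
      -- conversely, every such parametrization defines a helix surface
      (∀ (I : Set ℝ) (ξ : ℝ) (ξ₁ ξ₂ ξ₃ : ℝ → ℝ), AntiDeSitter.IsAdmissible I ξ₁ ξ₂ ξ₃ →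
        ∀ Ω : TopologicalSpace.Opens (EuclideanSpace ℝ (Fin 2)),
          (∀ p ∈ Ω, p 1 ∈ I) →
          (∀ p ∈ Ω, Function.Injective (fderiv ℝ
            (AntiDeSitter.param κ lam (AntiDeSitter.slope τ lam ν) ξ ξ₁ ξ₂ ξ₃) p)) →
          AntiDeSitter.IsHelixSurface κ τ lam ν (fun p : Ω =>
            AntiDeSitter.param κ lam (AntiDeSitter.slope τ lam ν) ξ ξ₁ ξ₂ ξ₃ p))) := by
  have hlam2 : lam ^ 2 = 1 := by rcases hlam with rfl | rfl <;> norm_num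
  refine ⟨fun M _ _ _ f hf p => ⟨?_, ?_⟩, fun hu => ⟨?_, ?_⟩⟩
  · obtain ⟨N, hN⟩ := hf.exists_isLocalHelix p
    exact hN.pos hκ hτ hlam2 ((chartAt _ p).map_source (mem_chart_source _ p))
  · obtain ⟨e, he, hp, I, ξ, ξ₁, ξ₂, ξ₃, hadm, hparam⟩ := hf.exists_chart hκ hτ hlam hB p
    exact ⟨e, he, hp, I, ξ, ξ₁, ξ₂, ξ₃, hadm, fun y _ =>
      ⟨AntiDeSitter.isPseudoOrthogonal_matA _ _ _ _, AntiDeSitter.matA_commute_J1 _ _ _ _⟩, hparam⟩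
  · rintro d r₁ r₂ rfl rfl rfl
    obtain ⟨-, hd, -⟩ := AntiDeSitter.slope_facts hτ hB hu
    have hk := Real.sqrt_pos.2 hκ
    have hd' : 0 < √(AntiDeSitter.slope τ lam ν ^ 2 - 1) := Real.sqrt_pos.2 (by nlinarith)
    have h1 : 0 < AntiDeSitter.slope τ lam ν := by linarith
    exact ⟨hd, AntiDeSitter.isLorentzTorus (by positivity) (by positivity),
      AntiDeSitter.torus_subset_AdS hκ hd, AntiDeSitter.isTwistedGeodesic_curve hκ hlam2 hd⟩
  · intro I ξ ξ₁ ξ₂ ξ₃ hadm Ω hΩ himm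
    exact AntiDeSitter.isHelixSurface_param hκ hτ hlam hB hu hadm Ω hΩ himm
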